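/- Let $n,p,q,s_x,s_y,D_n$ be natural numbers with $1\le s_x\le p$, $1\le s_y\le q$, and let $B>0$ be real. Let $\pi_x$ be the sparse Rademacher prior on $\mathbb R^p$: $\alpha\sim\pi_x$ has i.i.d. coordinates equal to $1/\sqrt{s_x}$ and $-1/\sqrt{s_x}$ with probability $s_x/(2p)$ each and to $0$ with probability $1-s_x/p$. Let $\pi_y$ be the analogous prior on $\mathbb R^q$ with sparsity $s_y$, and let $\alpha\sim\pi_x$, $\beta\sim\pi_y$ be independent. Let $\mathbb Q=N_{p+q}(0,I_{p+q})$ and $$\mathbb P_{\alpha,\beta}=\begin{cases}N_{p+q}\left(0,\begin{pmatrix}I_p&B^{-1}\alpha\beta^T\\B^{-1}\beta\alpha^T&I_q\end{pmatrix}\right)&\text{if }\|\alpha\|_2\|\beta\|_2<B,\\ \mathbb Q&\text{otherwise.}\end{cases}$$ Let $\mathbb Q_n=\mathbb Q^{\otimes n}$ and $\mathbb P_{n,\alpha,\beta}=\mathbb P_{\alpha,\beta}^{\otimes n}$, let $\mathbb L_n=d\big(\mathbb E_{\alpha\sim\pi_x,\beta\sim\pi_y}\mathbb P_{n,\alpha,\beta}\big)/d\mathbb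 Q_n$ be the likelihood ratio, and let $\mathbb L_n^{\le D_n}$ be its orthogonal projection in $L_2(\mathbb Q_n)$ onto the linear span of all $n(p+q)$-variate Hermite polynomials of degree at most $D_n$. Suppose $$D_n\le\min(\sqrt p,\sqrt q,n),\qquad s_x,s_y\ge\frac{\sqrt{e\,n\,D_n}}{B},\qquad p,q\ge\frac{3en}{B^2}.$$ Then the mixture $\mathbb E_{\alpha\sim\pi_x,\beta\sim\pi_y}\mathbb P_{n,\alpha,\beta}$ is absolutely continuous with respect to $\mathbb Q_n$, $\mathbb L_n\in L_2(\mathbb Q_n)$, and $\|\mathbb L_n^{\le D_n}\|^2_{L_2(\mathbb Q_n)}=O(1)$; that is, it is at most a constant $C$ that does not depend on $n,p,q,s_x,s_y,D_n,B$. -/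

import Mathlib

open MeasureTheory ProbabilityTheory
open scoped ENNReal NNReal

namespace SparseCCA

/-- One observation `(X, Y) ∈ ℝ^p × ℝ^q`, seen as a vector of `ℝ^(p+q)`. -/
abbrev Obs (p q : ℕ) : Type := EuclideanSpace ℝ (Fin p ⊕ Fin q)

/-- The sample `(X_i, Y_i)`, `i = 1, …, n`. -/
abbrev Sample (n p q : ℕ) : Type := Fin n → Obs p q

/-- Index set of the `n (p + q)` real coordinates of the sample. -/
abbrev Idx (n p q : ℕ) : Type := Fin n × (Fin p ⊕ Fin q)

/-- The null distribution `N_{p+q}(0, I)` of one observation. -/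
noncomputable def nullObs (p q : ℕ) : Measure (Obs p q) := stdGaussian (Obs p q)

/-- The null distribution of the sample: the `n`-fold product of `N_{p+q}(0, I)`. -/
noncomputable def nullSample (n p q : ℕ) : Measure (Sample n p q) :=
  Measure.pi fun _ => nullObs p q

/-- The law of one coordinate under the sparse Rademacher prior with sparsity `s` in dimension
`m`: the values `1 / √s` and `-1 / √s` with probability `s / (2 m)` each, and `0` with
probability `1 - s / m`. -/
noncomputable def coordPrior (m s : ℕ) : Measure ℝ :=
  ENNReal.ofReal ((s : ℝ) / (2 * m)) • Measure.dirac (1 / √(s : ℝ)) +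
  ENNReal.ofReal ((s : ℝ) / (2 * m)) • Measure.dirac (-1 / √(s : ℝ)) +
  ENNReal.ofReal (1 - (s : ℝ) / m) • Measure.dirac 0

/-- The sparse Rademacher prior on `ℝ^m`: i.i.d. coordinates with law `coordPrior m s`. -/
noncomputable def prior (m s : ℕ) : Measure (EuclideanSpace ℝ (Fin m)) :=
  (Measure.pi fun _ : Fin m => coordPrior m s).map (WithLp.toLp 2)

/-- The covariance matrix with identity diagonal blocks, upper right block `ρ α βᵀ` and lower left
block `ρ β αᵀ`. -/
noncomputable def covMatrix {p q : ℕ} (α : EuclideanSpace ℝ (Fin p))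
    (β : EuclideanSpace ℝ (Fin q)) (ρ : ℝ) : Matrix (Fin p ⊕ Fin q) (Fin p ⊕ Fin q) ℝ :=
  Matrix.fromBlocks 1 (ρ • Matrix.vecMulVec α β) (ρ • Matrix.vecMulVec β α) 1

open scoped Classical in
/-- The law of one observation given `(α, β)`: `N(0, Σ(α, β, 1/B))` if `‖α‖ ‖β‖ < B`, and the
null distribution otherwise. -/
noncomputable def altObs {p q : ℕ} (B : ℝ) (α : EuclideanSpace ℝ (Fin p))
    (β : EuclideanSpace ℝ (Fin q)) : Measure (Obs p q) :=
  if ‖α‖ * ‖β‖ < B then multivariateGaussian 0 (covMatrix α β (1 / B)) else nullObs p q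

/-- The law of the sample given `(α, β)`. -/
noncomputable def altSample (n : ℕ) {p q : ℕ} (B : ℝ) (α : EuclideanSpace ℝ (Fin p))
    (β : EuclideanSpace ℝ (Fin q)) : Measure (Sample n p q) :=
  Measure.pi fun _ => altObs B α β

/-- The joint prior of `(α, β)`: independent sparse Rademacher priors. -/
noncomputable def jointPrior (p q sx sy : ℕ) :
    Measure (EuclideanSpace ℝ (Fin p) × EuclideanSpace ℝ (Fin q)) :=
  (prior p sx).prod (prior q sy)

/-- The marginal law of the sample when `(α, β)` is drawn from the prior. -/
noncomputable def mixture (n p q sx sy : ℕ) (B : ℝ) : Measure (Sample n p q) :=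
  (jointPrior p q sx sy).bind fun ab => altSample n B ab.1 ab.2

/-- The likelihood ratio: the density of the marginal law with respect to the null law. -/
noncomputable def likelihoodRatio (n p q sx sy : ℕ) (B : ℝ) (z : Sample n p q) : ℝ :=
  ((mixture n p q sx sy B).rnDeriv (nullSample n p q) z).toReal

/-- The multivariate (probabilists') Hermite polynomial with degree index `w`. -/
noncomputable def hermiteFun {n p q : ℕ} (w : Idx n p q → ℕ) (z : Sample n p q) : ℝ :=
  ∏ k : Idx n p q, Polynomial.aeval (z k.1 k.2) (Polynomial.hermite (w k))

instance (m s : ℕ) : IsFiniteMeasure (coordPrior m s) := by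
  constructor
  simp only [coordPrior, Measure.add_apply, Measure.smul_apply, measure_univ, smul_eq_mul, mul_one]
  simp [ENNReal.add_lt_top]

instance (m s : ℕ) : IsFiniteMeasure (prior m s) := by
  unfold prior; infer_instance

theorem isProbabilityMeasure_coordPrior {m s : ℕ} (hs : 0 < s) (hsm : s ≤ m) :
    IsProbabilityMeasure (coordPrior m s) := by
  have hm : (0 : ℝ) < m := by exact_mod_cast hs.trans_le hsm
  have h1 : (s : ℝ) / m ≤ 1 := (div_le_one hm).2 (by exact_mod_cast hsm)
  constructor
  simp only [coordPrior, Measure.add_apply, Measure.smul_apply, measure_univ, smul_eq_mul, mul_one]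
  rw [← ENNReal.ofReal_add (by positivity) (by positivity),
    ← ENNReal.ofReal_add (by positivity) (by linarith), ← ENNReal.ofReal_one]
  congr 1
  field_simp
  ring

/-- The finite set of possible values under the prior. -/
def priorSupport (m s : ℕ) : Set (EuclideanSpace ℝ (Fin m)) :=
  WithLp.toLp 2 '' Set.pi Set.univ
    (fun _ => ({1 / √(s : ℝ), -1 / √(s : ℝ), 0} : Set ℝ))

theorem finite_priorSupport (m s : ℕ) : (priorSupport m s).Finite :=
  (Set.Finite.pi fun _ => by simp).image _

theorem ae_mem_priorSupport (m s : ℕ) : ∀ᵐ x ∂prior m s, x ∈ priorSupport m s := by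
  have h0 : ∀ᵐ x ∂coordPrior m s, x ∈ ({1 / √(s : ℝ), -1 / √(s : ℝ), 0} : Set ℝ) := by
    rw [ae_iff]
    simp [coordPrior]
  have h1 : ∀ᵐ x ∂Measure.pi (fun _ : Fin m => coordPrior m s),
      ∀ i, x i ∈ ({1 / √(s : ℝ), -1 / √(s : ℝ), 0} : Set ℝ) :=
    ae_all_iff.2 fun i => (Measure.tendsto_eval_ae_ae (i := i)).eventually h0
  refine (ae_map_iff (p := fun x => x ∈ priorSupport m s) (by fun_prop)
    (finite_priorSupport m s).measurableSet).2 ?_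
  filter_upwards [h1] with x hx
  exact ⟨x, fun i _ => hx i, rfl⟩

/-- The mixture is a genuine mixture: every function of `(α, β)` is almost everywhere measurable
under the finitely supported prior. -/
theorem aemeasurable_jointPrior {γ : Type*} [MeasurableSpace γ] {p q : ℕ} (sx sy : ℕ)
    (f : EuclideanSpace ℝ (Fin p) × EuclideanSpace ℝ (Fin q) → γ) :
    AEMeasurable f (jointPrior p q sx sy) := by
  classical
  set S := priorSupport p sx ×ˢ priorSupport q sy
  have hS : S.Finite := (finite_priorSupport p sx).prod (finite_priorSupport q sy)
  have hmem : ∀ᵐ x ∂jointPrior p q sx sy, x ∈ S := by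
    have h1 := Measure.quasiMeasurePreserving_fst.ae
      (μa := (prior p sx).prod (prior q sy)) (ae_mem_priorSupport p sx)
    have h2 := Measure.quasiMeasurePreserving_snd.ae
      (μa := (prior p sx).prod (prior q sy)) (ae_mem_priorSupport q sy)
    filter_upwards [h1, h2] with x hx1 hx2
    exact ⟨hx1, hx2⟩
  rw [← Measure.restrict_eq_self_of_ae_mem hmem,
    aemeasurable_restrict_iff_comap_subtype hS.measurableSet]
  have := hS.countable.to_subtype
  exact (measurable_of_countable _).aemeasurable

instance (p q : ℕ) : IsProbabilityMeasure (nullObs p q) := by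
  unfold nullObs; infer_instance

instance (p q : ℕ) : IsGaussian (nullObs p q) := by
  unfold nullObs; infer_instance

instance (n p q : ℕ) : IsProbabilityMeasure (nullSample n p q) := by
  unfold nullSample; infer_instance

theorem memLp_coord {n p q : ℕ} (k : Idx n p q) (r : ℝ≥0) :
    MemLp (fun z : Sample n p q => z k.1 k.2) r (nullSample n p q) := by
  have h1 : MemLp (fun x : Obs p q => x k.2) r (nullObs p q) :=
    IsGaussian.memLp_dual (nullObs p q) (EuclideanSpace.proj k.2 : Obs p q →L[ℝ] ℝ) r
      ENNReal.coe_ne_top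
  exact h1.comp_measurePreserving (measurePreserving_eval (fun _ : Fin n => nullObs p q) k.1)

theorem memLp_mul {Ω : Type*} [MeasurableSpace Ω] {μ : Measure Ω} {f g : Ω → ℝ}
    (hf : ∀ r : ℝ≥0, MemLp f r μ) (hg : ∀ r : ℝ≥0, MemLp g r μ) (r : ℝ≥0) :
    MemLp (fun x => f x * g x) r μ := by
  have : ENNReal.HolderTriple ((2 * r : ℝ≥0) : ℝ≥0∞) ((2 * r : ℝ≥0) : ℝ≥0∞) (r : ℝ≥0∞) := by
    constructor
    rcases eq_or_ne r 0 with rfl | hr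
    · simp
    · rw [← ENNReal.coe_inv (by positivity), ← ENNReal.coe_inv hr, ← ENNReal.coe_add]
      congr 1
      field_simp
      norm_num
  exact (hg (2 * r)).mul' (hf (2 * r))

theorem memLp_polynomial {n p q : ℕ} (k : Idx n p q) (P : Polynomial ℤ) (r : ℝ≥0) :
    MemLp (fun z : Sample n p q => Polynomial.aeval (z k.1 k.2) P) r (nullSample n p q) := by
  induction P using Polynomial.induction_on' generalizing r with
  | add P Q hP hQ =>
    simp only [map_add]
    exact (hP r).add (hQ r)
  | monomial d a =>
    have hpow : ∀ (d : ℕ) (r : ℝ≥0),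
        MemLp (fun z : Sample n p q => (z k.1 k.2) ^ d) r (nullSample n p q) := by
      intro d
      induction d with
      | zero => intro r; simpa using memLp_const (1 : ℝ)
      | succ d ih => intro r; simpa [pow_succ] using memLp_mul ih (memLp_coord k) r
    simpa [Polynomial.aeval_monomial] using (hpow d r).const_mul (a : ℝ)

theorem memLp_hermiteFun {n p q : ℕ} (w : Idx n p q → ℕ) :
    MemLp (hermiteFun w) 2 (nullSample n p q) := by
  have key : ∀ (S : Finset (Idx n p q)) (r : ℝ≥0),
      MemLp (fun z : Sample n p q =>
        ∏ k ∈ S, Polynomial.aeval (z k.1 k.2) (Polynomial.hermite (w k))) r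
        (nullSample n p q) := by
    intro S
    induction S using Finset.induction_on with
    | empty => intro r; simpa using memLp_const (1 : ℝ)
    | insert a S ha ih =>
      intro r
      simpa [Finset.prod_insert ha] using
        memLp_mul (memLp_polynomial a (Polynomial.hermite (w a))) ih r
  exact key Finset.univ 2

/-- The Hermite polynomial with degree index `w`, as an element of `L²` of the null law. -/
noncomputable def hermiteL2 {n p q : ℕ} (w : Idx n p q → ℕ) : Lp ℝ 2 (nullSample n p q) :=
  (memLp_hermiteFun w).toLp (hermiteFun w)

/-- The linear span in `L²` of the null law of all Hermite polynomials of degree at most `D`. -/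
noncomputable def lowDegSpace (n p q D : ℕ) : Submodule ℝ (Lp ℝ 2 (nullSample n p q)) :=
  Submodule.span ℝ (hermiteL2 '' {w : Idx n p q → ℕ | ∑ k, w k ≤ D})

instance (n p q D : ℕ) : FiniteDimensional ℝ (lowDegSpace n p q D) := by
  refine FiniteDimensional.span_of_finite ℝ (Set.Finite.image _ ?_)
  refine (Set.finite_Iic (fun _ : Idx n p q => D)).subset fun w hw k => ?_
  exact (Finset.single_le_sum (f := w) (fun _ _ => Nat.zero_le _) (Finset.mem_univ k)).trans hw

/-- The orthogonal projection of a square integrable function of the sample onto the span of the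
Hermite polynomials of degree at most `D`. -/
noncomputable def lowDegProj {n p q : ℕ} (D : ℕ) (f : Lp ℝ 2 (nullSample n p q)) :
    Lp ℝ 2 (nullSample n p q) :=
  (lowDegSpace n p q D).starProjection f

end SparseCCA

/-!
The likelihood ratio is a finite mixture, over pairs `(α, β)` in the support of the prior, of the
densities of Gaussian product laws. Given `(α, β)`, one observation has law `N(0, I + ρ A)`, where
`A` has off-diagonal blocks `α βᵀ`, `β αᵀ` and `ρ` is `1 / B` or, in the truncated case, `0`
(`altObs_eq`). Always `|ρ| ‖α‖ ‖β‖ < 1`, so the eigenvalues of the covariance lie strictly between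
`0` and `2`; in an eigenbasis the law is a product of one-dimensional Gaussian laws, each having a
square integrable density with respect to `N(0, 1)`. This gives absolute continuity and square
integrability (`hasSqDensity_mixture`).

The Hermite polynomials are orthogonal, so the squared norm of the projection is the sum of the
squared Hermite moments `E h_w` of the mixture, each divided by `w!` (`norm_sq_lowDegProj`). For a
centred Gaussian vector with covariance `S`, the exponential generating function of the moments
`E h_w` is `exp (lᵀ (S - I) l / 2)` (`sum_integral_obsHermite` and its
one-dimensional input `integral_scaledHermite_even`), here `exp (ρ ⟨a, α⟩ ⟨b, β⟩)` with
`l = (a, b)`. Comparing coefficients gives the moments explicitly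
(`integral_obsHermite_covMatrix`). For two parameters `(α, β)`, `(α', β')` the products of their
moments divided by `w!`, summed over total degree `2 d`, then equal
`multichoose n d * (ρ ρ' ⟨α, α'⟩ ⟨β, β'⟩) ^ d`; odd degrees contribute nothing
(`sum_integral_hermiteFun_mul`).

It remains to average over two independent draws. The indicator of the truncation is removed by
absolute values, which decouples the two blocks. The overlap `⟨α, α'⟩` is a sum of `p` i.i.d.
terms, with moment generating function `(1 + (s / p)² (cosh (τ / s) - 1)) ^ p`
(`sum_priorWeight_exp`), whence
`E |⟨α, α'⟩| ^ d ≤ 2 d! τ ^ (-d) exp (3 τ² / (4 p))` for `0 < τ ≤ s`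
(`sum_priorWeight_abs_pow_le`). The choice `τ² = 2 d e n / B²` is allowed by the lower bound on the
sparsities, and the lower bound on the dimensions makes the exponential at most `e ^ (d / 2)`. Since
`multichoose n d * d! ≤ (n + d) ^ d ≤ (3 n / 2) ^ d`, degree `2 d` contributes at most
`4 (3 / 4) ^ d`, and these terms sum to at most `16`.
-/

namespace SparseCCA

/-! ### One-dimensional Gaussian calculus -/

open Polynomial in
theorem integrable_eval_gaussianReal (P : ℝ[X]) (v : ℝ≥0) :
    Integrable (fun x => P.eval x) (gaussianReal 0 v) := by
  induction P using Polynomial.induction_on' with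
  | add P Q hP hQ =>
    simp only [eval_add]
    exact hP.add hQ
  | monomial k a =>
    have h : MemLp (id : ℝ → ℝ) (k : ℝ≥0) (gaussianReal 0 v) := memLp_id_gaussianReal k
    have h2 : Integrable (fun x : ℝ => x ^ k) (gaussianReal 0 v) := by
      rcases Nat.eq_zero_or_pos k with rfl | hk
      · simp
      · have := h.integrable_norm_pow (by positivity)
        refine (this.congr' ?_ ?_)
        · fun_prop
        · filter_upwards with x
          simp
    simpa [eval_monomial] using h2.const_mul a

open Polynomial in
/-- Gaussian integration by parts (Stein's identity) for polynomials. -/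
theorem integral_mul_eval_gaussianReal (P : ℝ[X]) (v : ℝ≥0) :
    ∫ x, x * P.eval x ∂gaussianReal 0 v = v * ∫ x, P.derivative.eval x ∂gaussianReal 0 v := by
  rcases eq_or_ne v 0 with rfl | hv
  · simp
  have hv' : (v : ℝ) ≠ 0 := by exact_mod_cast hv
  have hint : ∀ Q : ℝ[X], Integrable (fun x => gaussianPDFReal 0 v x * Q.eval x) := by
    intro Q
    have := integrable_eval_gaussianReal Q v
    rw [gaussianReal_of_var_ne_zero 0 hv,
      integrable_withDensity_iff_integrable_smul' (measurable_gaussianPDF 0 v)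
        (ae_of_all _ fun _ => gaussianPDF_lt_top)] at this
    simpa [toReal_gaussianPDF] using this
  have hderiv : ∀ x, HasDerivAt (fun x => gaussianPDFReal 0 v x * P.eval x)
      (gaussianPDFReal 0 v x * (P.derivative - C (1 / (v : ℝ)) * (X * P)).eval x) x := by
    intro x
    have h1 : HasDerivAt (gaussianPDFReal 0 v) (gaussianPDFReal 0 v x * (-x / v)) x := by
      have h2 : HasDerivAt (fun x : ℝ => -(x - 0) ^ 2 / (2 * (v : ℝ))) (-x / v) x := by
        have := ((((hasDerivAt_id x).sub_const 0).pow 2).neg).div_const (2 * (v : ℝ))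
        refine this.congr_deriv ?_
        simp
        field_simp
      have := h2.exp.const_mul (√(2 * Real.pi * v))⁻¹
      refine this.congr_deriv ?_
      simp [gaussianPDFReal]
      ring
    refine (h1.mul (P.hasDerivAt x)).congr_deriv ?_
    simp
    ring
  have h0 := integral_eq_zero_of_hasDerivAt_of_integrable hderiv (hint _) (hint _)
  have h1 : ∫ x, (P.derivative - C (1 / (v : ℝ)) * (X * P)).eval x ∂gaussianReal 0 v = 0 := by
    rw [integral_gaussianReal_eq_integral_smul hv]
    simpa using h0
  have h2 : ∀ x : ℝ, (P.derivative - C (1 / (v : ℝ)) * (X * P)).eval x =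
      P.derivative.eval x - (1 / (v : ℝ)) * (X * P).eval x := by intro x; simp
  simp_rw [h2] at h1
  rw [integral_sub (integrable_eval_gaussianReal _ v)
    ((integrable_eval_gaussianReal _ v).const_mul _), integral_const_mul] at h1
  simp only [eval_mul, eval_X] at h1
  field_simp at h1
  linarith

open Polynomial in
/-- The probabilists' Hermite polynomials with real coefficients. -/
noncomputable def realHermite (k : ℕ) : ℝ[X] := (hermite k).map (Int.castRingHom ℝ)

open Polynomial in
theorem aeval_hermite (k : ℕ) (x : ℝ) : aeval x (hermite k) = (realHermite k).eval x := by
  simp [realHermite, eval_map, aeval_def]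

open Polynomial in
theorem realHermite_zero : realHermite 0 = 1 := by simp [realHermite]

open Polynomial in
theorem realHermite_succ (k : ℕ) :
    realHermite (k + 1) = X * realHermite k - derivative (realHermite k) := by
  simp [realHermite, hermite_succ, derivative_map]

open Polynomial in
theorem derivative_realHermite_succ (k : ℕ) :
    derivative (realHermite (k + 1)) = C ((k : ℝ) + 1) * realHermite k := by
  induction k with
  | zero => simp [realHermite_succ, realHermite_zero]
  | succ k ih =>
    rw [realHermite_succ (k + 1), ih, derivative_sub, derivative_mul, ih, derivative_C_mul,
      realHermite_succ k]
    simp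
    ring

open Polynomial in
theorem realHermite_add_two (k : ℕ) :
    realHermite (k + 2) = X * realHermite (k + 1) - C ((k : ℝ) + 1) * realHermite k := by
  rw [realHermite_succ (k + 1), derivative_realHermite_succ]

open Polynomial in
theorem integral_realHermite_succ_mul (j : ℕ) (P : ℝ[X]) :
    ∫ x, (realHermite (j + 1)).eval x * P.eval x ∂gaussianReal 0 1 =
      ∫ x, (realHermite j).eval x * P.derivative.eval x ∂gaussianReal 0 1 := by
  have h := integral_mul_eval_gaussianReal (realHermite j * P) 1
  have e1 : ∀ x : ℝ, (realHermite (j + 1)).eval x * P.eval x =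
      (X * (realHermite j * P)).eval x - (derivative (realHermite j) * P).eval x := by
    intro x; simp [realHermite_succ]; ring
  have e2 : ∀ x : ℝ, (derivative (realHermite j * P)).eval x =
      (derivative (realHermite j) * P).eval x + (realHermite j * P.derivative).eval x := by
    intro x; simp [derivative_mul]
  simp_rw [e1, e2] at *
  rw [integral_sub (integrable_eval_gaussianReal _ _) (integrable_eval_gaussianReal _ _)]
  rw [integral_add (integrable_eval_gaussianReal _ _) (integrable_eval_gaussianReal _ _)] at h
  simp only [eval_mul, eval_X, NNReal.coe_one, one_mul] at h ⊢
  linarith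

theorem integral_realHermite_mul (j k : ℕ) :
    ∫ x, (realHermite j).eval x * (realHermite k).eval x ∂gaussianReal 0 1 =
      if j = k then (j.factorial : ℝ) else 0 := by
  induction j generalizing k with
  | zero =>
    cases k with
    | zero => simp [realHermite_zero]
    | succ k =>
      have := integral_realHermite_succ_mul k 1
      simpa [realHermite_zero] using this
  | succ j ih =>
    rw [integral_realHermite_succ_mul]
    cases k with
    | zero => simp [realHermite_zero]
    | succ k =>
      rw [derivative_realHermite_succ]
      have : ∀ x : ℝ, (realHermite j).eval x * (Polynomial.C ((k : ℝ) + 1) * realHermite k).eval x =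
          ((k : ℝ) + 1) * ((realHermite j).eval x * (realHermite k).eval x) := by
        intro x; simp; ring
      simp_rw [this]
      rw [integral_const_mul, ih]
      by_cases h : j = k
      · subst h; simp [Nat.factorial_succ]
      · simp [h]

open Polynomial in
/-- The normalised Hermite polynomials of variance `b`: the coefficients of `t ^ N` in
`exp (x t - b t² / 2)`. -/
noncomputable def scaledHermite (b : ℝ) : ℕ → ℝ[X]
  | 0 => 1
  | N + 1 => C (1 / ((N : ℝ) + 1)) *
      (X * scaledHermite b N - C b * derivative (scaledHermite b N))

open Polynomial in
theorem derivative_scaledHermite_succ (b : ℝ) (N : ℕ) :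
    derivative (scaledHermite b (N + 1)) = scaledHermite b N := by
  induction N with
  | zero => simp [scaledHermite]
  | succ N ih =>
    have hN : (N : ℝ) + 1 + 1 ≠ 0 := by positivity
    have hN' : (N : ℝ) + 1 ≠ 0 := by positivity
    have e : C ((N : ℝ) + 1) * scaledHermite b (N + 1) =
        X * scaledHermite b N - C b * derivative (scaledHermite b N) := by
      rw [scaledHermite, ← mul_assoc, ← C_mul, mul_one_div_cancel hN', C_1, one_mul]
    rw [scaledHermite, derivative_C_mul, derivative_sub, derivative_mul, derivative_C_mul, ih]
    have : derivative X * scaledHermite b (N + 1) + X * scaledHermite b N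
        - C b * derivative (scaledHermite b N) =
        C ((N : ℝ) + 1 + 1) * scaledHermite b (N + 1) := by
      rw [add_sub_assoc, ← e, show C ((N : ℝ) + 1 + 1) = C ((N : ℝ) + 1) + C 1 from C_add]
      simp
      ring
    push_cast
    rw [this, ← mul_assoc, ← C_mul, one_div_mul_cancel hN, C_1, one_mul]

/-- Any sequence with the three-term recursion of the coefficients of `exp (x t - b t² / 2)` is
given by the normalised Hermite polynomials. -/
theorem eq_eval_scaledHermite {b x : ℝ} {c : ℕ → ℝ} (h0 : c 0 = 1) (h1 : c 1 = x)
    (h2 : ∀ N : ℕ, ((N : ℝ) + 2) * c (N + 2) = x * c (N + 1) - b * c N) (N : ℕ) :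
    c N = (scaledHermite b N).eval x := by
  induction N using Nat.strong_induction_on with
  | _ N ih =>
    match N with
    | 0 => simp [h0, scaledHermite]
    | 1 => simp [h1, scaledHermite]
    | N + 2 =>
      have hN : (N : ℝ) + 2 ≠ 0 := by positivity
      have hN' : (N : ℝ) + 1 + 1 ≠ 0 := by positivity
      have := h2 N
      rw [scaledHermite, derivative_scaledHermite_succ]
      rw [ih (N + 1) (by omega), ih N (by omega)] at this
      simp only [Polynomial.eval_mul, Polynomial.eval_C, Polynomial.eval_sub, Polynomial.eval_X]
      rw [← this]
      push_cast
      field_simp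
      ring

theorem integral_scaledHermite_add_two (b : ℝ) (v : ℝ≥0) (N : ℕ) :
    ∫ x, (scaledHermite b (N + 2)).eval x ∂gaussianReal 0 v =
      (v - b) / (N + 2) * ∫ x, (scaledHermite b N).eval x ∂gaussianReal 0 v := by
  have h := integral_mul_eval_gaussianReal (scaledHermite b (N + 1)) v
  have e : ∀ x : ℝ, (scaledHermite b (N + 2)).eval x =
      1 / ((N : ℝ) + 2) * ((Polynomial.X * scaledHermite b (N + 1)).eval x
        - b * (scaledHermite b N).eval x) := by
    intro x
    rw [scaledHermite, derivative_scaledHermite_succ]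
    simp
    left
    ring
  simp_rw [e]
  rw [integral_const_mul, integral_sub (integrable_eval_gaussianReal _ _)
    ((integrable_eval_gaussianReal _ _).const_mul _), integral_const_mul]
  rw [derivative_scaledHermite_succ] at h
  simp only [Polynomial.eval_mul, Polynomial.eval_X]
  rw [h]
  ring

theorem integral_scaledHermite_even (b : ℝ) (v : ℝ≥0) (k : ℕ) :
    ∫ x, (scaledHermite b (2 * k)).eval x ∂gaussianReal 0 v =
      ((v - b) / 2) ^ k / k.factorial := by
  induction k with
  | zero => simp [scaledHermite]
  | succ k ih =>
    rw [show 2 * (k + 1) = 2 * k + 2 by ring, integral_scaledHermite_add_two, ih,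
      Nat.factorial_succ]
    push_cast
    field_simp
    ring

theorem integral_scaledHermite_odd (b : ℝ) (v : ℝ≥0) (k : ℕ) :
    ∫ x, (scaledHermite b (2 * k + 1)).eval x ∂gaussianReal 0 v = 0 := by
  induction k with
  | zero => simp [scaledHermite]
  | succ k ih =>
    rw [show 2 * (k + 1) + 1 = 2 * k + 1 + 2 by ring, integral_scaledHermite_add_two, ih, mul_zero]

/-! ### Square integrable densities -/

/-- `ν` has a density with respect to `μ`, and this density is square integrable. The density takes
values in `ℝ≥0∞`, so no integrability has to be carried along for `ν` itself. -/
def HasSqDensity {Ω : Type*} [MeasurableSpace Ω] (ν μ : Measure Ω) : Prop :=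
  ∃ f : Ω → ℝ≥0∞, Measurable f ∧ ν = μ.withDensity f ∧ ∫⁻ x, f x ^ 2 ∂μ ≠ ∞

section HasSqDensity

variable {Ω : Type*} [MeasurableSpace Ω] {μ ν ν' : Measure Ω}

theorem HasSqDensity.zero : HasSqDensity 0 μ :=
  ⟨fun _ => 0, measurable_const, by simp, by simp⟩

theorem HasSqDensity.add (h : HasSqDensity ν μ) (h' : HasSqDensity ν' μ) :
    HasSqDensity (ν + ν') μ := by
  obtain ⟨f, hf, rfl, hf2⟩ := h
  obtain ⟨g, hg, rfl, hg2⟩ := h'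
  refine ⟨f + g, hf.add hg, (withDensity_add_left hf g).symm, ?_⟩
  have hle : ∀ a b : ℝ≥0∞, (a + b) ^ 2 ≤ 4 * (a ^ 2 + b ^ 2) := by
    intro a b
    rcases le_total a b with hab | hab
    · calc (a + b) ^ 2 ≤ (b + b) ^ 2 := by gcongr
        _ = 4 * b ^ 2 := by ring
        _ ≤ _ := by gcongr; exact le_add_self
    · calc (a + b) ^ 2 ≤ (a + a) ^ 2 := by gcongr
        _ = 4 * a ^ 2 := by ring
        _ ≤ _ := by gcongr; exact le_self_add
  refine ne_top_of_le_ne_top ?_ (lintegral_mono fun x => hle (f x) (g x))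
  rw [lintegral_const_mul _ (by fun_prop), lintegral_add_left (by fun_prop)]
  finiteness

theorem HasSqDensity.smul (h : HasSqDensity ν μ) {c : ℝ≥0∞} (hc : c ≠ ∞) :
    HasSqDensity (c • ν) μ := by
  obtain ⟨f, hf, rfl, hf2⟩ := h
  refine ⟨c • f, hf.const_smul c, (withDensity_smul c hf).symm, ?_⟩
  simp only [Pi.smul_apply, smul_eq_mul, mul_pow]
  rw [lintegral_const_mul _ (by fun_prop)]
  finiteness

theorem HasSqDensity.sum {ι : Type*} (s : Finset ι) {ν : ι → Measure Ω}
    (h : ∀ i ∈ s, HasSqDensity (ν i) μ) : HasSqDensity (∑ i ∈ s, ν i) μ := by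
  classical
  induction s using Finset.induction_on with
  | empty => simpa using HasSqDensity.zero
  | insert a s ha ih =>
    rw [Finset.sum_insert ha]
    exact (h a (by simp)).add (ih fun i hi => h i (by simp [hi]))

theorem HasSqDensity.map {Ω' : Type*} [MeasurableSpace Ω'] (h : HasSqDensity ν μ)
    (e : Ω ≃ᵐ Ω') : HasSqDensity (ν.map e) (μ.map e) := by
  obtain ⟨f, hf, rfl, hf2⟩ := h
  refine ⟨f ∘ e.symm, hf.comp e.symm.measurable, ?_, ?_⟩
  · ext s hs
    rw [e.map_apply, withDensity_apply _ (e.measurable hs), withDensity_apply _ hs,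
      ← lintegral_indicator hs, ← lintegral_indicator (e.measurable hs), lintegral_map_equiv]
    refine lintegral_congr fun x => ?_
    by_cases hx : e x ∈ s <;> simp [Set.indicator, hx]
  · rw [lintegral_map_equiv]
    simpa using hf2

theorem HasSqDensity.absolutelyContinuous (h : HasSqDensity ν μ) : ν ≪ μ := by
  obtain ⟨f, hf, rfl, hf2⟩ := h
  exact withDensity_absolutelyContinuous μ f

theorem HasSqDensity.memLp_rnDeriv [SigmaFinite μ] (h : HasSqDensity ν μ) :
    MemLp (fun x => (ν.rnDeriv μ x).toReal) 2 μ := by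
  obtain ⟨f, hf, rfl, hf2⟩ := h
  have hae : (fun x => ((μ.withDensity f).rnDeriv μ x).toReal) =ᵐ[μ] fun x => (f x).toReal := by
    filter_upwards [Measure.rnDeriv_withDensity μ hf] with x hx
    rw [hx]
  refine MemLp.ae_eq hae.symm ⟨hf.ennreal_toReal.aestronglyMeasurable, ?_⟩
  rw [eLpNorm_lt_top_iff_lintegral_rpow_enorm_lt_top (by simp) (by simp)]
  refine lt_of_le_of_lt (lintegral_mono fun x => ?_) hf2.lt_top
  simp only [ENNReal.toReal_ofNat, ENNReal.rpow_ofNat]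
  gcongr
  rw [Real.enorm_of_nonneg ENNReal.toReal_nonneg]
  exact ENNReal.ofReal_toReal_le

end HasSqDensity

theorem lintegral_pi_prod {ι : Type*} [Fintype ι] {X : ι → Type*} [∀ i, MeasurableSpace (X i)]
    (μ : ∀ i, Measure (X i)) [∀ i, IsProbabilityMeasure (μ i)] {f : ∀ i, X i → ℝ≥0∞}
    (hf : ∀ i, Measurable (f i)) :
    ∫⁻ x, ∏ i, f i (x i) ∂Measure.pi μ = ∏ i, ∫⁻ x, f i x ∂μ i := by
  have hind : iIndepFun (fun i (x : ∀ i, X i) => f i (x i)) (Measure.pi μ) :=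
    iIndepFun_pi (fun i => (hf i).aemeasurable)
  rw [lintegral_prod_eq_prod_lintegral_of_indepFun Finset.univ _ hind (fun i => by fun_prop)]
  refine Finset.prod_congr rfl fun i _ => ?_
  exact (measurePreserving_eval μ i).lintegral_comp (hf i)

theorem HasSqDensity.pi {ι : Type*} [Fintype ι] {X : ι → Type*} [∀ i, MeasurableSpace (X i)]
    {μ ν : ∀ i, Measure (X i)} [∀ i, IsProbabilityMeasure (μ i)] [∀ i, SigmaFinite (ν i)]
    (h : ∀ i, HasSqDensity (ν i) (μ i)) : HasSqDensity (Measure.pi ν) (Measure.pi μ) := by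
  choose f hf hν hf2 using h
  refine ⟨fun x => ∏ i, f i (x i), by fun_prop, ?_, ?_⟩
  · symm
    refine (Measure.pi_eq fun s hs => ?_).symm
    rw [withDensity_apply _ (MeasurableSet.univ_pi hs),
      ← lintegral_indicator (MeasurableSet.univ_pi hs)]
    have : ∀ x, (Set.univ.pi s).indicator (fun x => ∏ i, f i (x i)) x =
        ∏ i, (s i).indicator (f i) (x i) := by
      intro x
      by_cases hx : x ∈ Set.univ.pi s
      · rw [Set.indicator_of_mem hx]
        exact Finset.prod_congr rfl fun i _ => (Set.indicator_of_mem (hx i trivial) _).symm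
      · rw [Set.indicator_of_notMem hx]
        simp only [Set.mem_pi, Set.mem_univ, forall_const, not_forall] at hx
        obtain ⟨i, hi⟩ := hx
        exact (Finset.prod_eq_zero (Finset.mem_univ i) (Set.indicator_of_notMem hi _)).symm
    simp_rw [this]
    rw [lintegral_pi_prod μ (fun i => (hf i).indicator (hs i))]
    refine Finset.prod_congr rfl fun i _ => ?_
    rw [lintegral_indicator (hs i), hν i, withDensity_apply _ (hs i)]
  · simp_rw [← Finset.prod_pow]
    rw [lintegral_pi_prod μ (fun i => (hf i).pow_const 2)]
    exact ENNReal.prod_ne_top fun i _ => hf2 i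

/-! ### Gaussian laws with covariance close to the identity -/

theorem hasSqDensity_gaussianReal {v : ℝ≥0} (hv : 0 < v) (hv2 : v < 2) :
    HasSqDensity (gaussianReal 0 v) (gaussianReal 0 1) := by
  -- The squared ratio times the density of `N(0, 1)` is a multiple of
  -- `exp (-(1 / v - 1 / 2) x²)`, which is integrable because `v < 2`.
  refine ⟨gaussianPDF 0 v / gaussianPDF 0 1,
    (measurable_gaussianPDF 0 v).div (measurable_gaussianPDF 0 1), ?_, ?_⟩
  · rw [gaussianReal_of_var_ne_zero 0 hv.ne', gaussianReal_of_var_ne_zero 0 one_ne_zero,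
      ← withDensity_mul _ (measurable_gaussianPDF 0 1)
        ((measurable_gaussianPDF 0 v).div (measurable_gaussianPDF 0 1))]
    congr 1
    ext x
    simp only [Pi.mul_apply, Pi.div_apply]
    rw [ENNReal.mul_div_cancel (gaussianPDF_pos 0 one_ne_zero x).ne' gaussianPDF_ne_top]
  · rw [gaussianReal_of_var_ne_zero 0 one_ne_zero,
      lintegral_withDensity_eq_lintegral_mul _ (measurable_gaussianPDF 0 1)
        (((measurable_gaussianPDF 0 v).div (measurable_gaussianPDF 0 1)).pow_const 2)]
    have hv0 : (0 : ℝ) < v := by exact_mod_cast hv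
    have hv2' : (v : ℝ) < 2 := by exact_mod_cast hv2
    have hb : 0 < 1 / (v : ℝ) - 1 / 2 := by
      rw [sub_pos]; exact one_div_lt_one_div_of_lt hv0 hv2'
    have hi := (integrable_exp_neg_mul_sq hb).const_mul
      ((√(2 * Real.pi * v))⁻¹ ^ 2 / (√(2 * Real.pi))⁻¹)
    refine ne_of_lt (lt_of_le_of_lt (le_of_eq (lintegral_congr fun x => ?_)) hi.lintegral_lt_top)
    have h1 := gaussianPDFReal_pos 0 1 x one_ne_zero
    have h2 := gaussianPDFReal_pos 0 v x hv.ne'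
    simp only [Pi.mul_apply, Pi.div_apply, gaussianPDF]
    rw [← ENNReal.ofReal_div_of_pos h1, ← ENNReal.ofReal_pow (by positivity),
      ← ENNReal.ofReal_mul h1.le]
    congr 1
    simp only [gaussianPDFReal]
    have e : Real.exp (-(1 / (v : ℝ) - 1 / 2) * x ^ 2) =
        Real.exp (-(x - 0) ^ 2 / (2 * v)) ^ 2 / Real.exp (-(x - 0) ^ 2 / (2 * (1 : ℝ≥0))) := by
      rw [← Real.exp_nat_mul, ← Real.exp_sub]
      congr 1
      push_cast
      field_simp
      ring
    rw [e]
    have := Real.pi_pos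
    simp only [NNReal.coe_one, mul_one]
    field_simp

open Matrix in
/-- A centred Gaussian law with covariance `S` has independent coordinates in an eigenbasis of `S`,
with the eigenvalues as variances. -/
theorem multivariateGaussian_eq_map_pi {ι : Type*} [Fintype ι] [DecidableEq ι]
    {S : Matrix ι ι ℝ} (hS : S.PosSemidef) :
    multivariateGaussian 0 S =
      (Measure.pi fun i => gaussianReal 0 (hS.1.eigenvalues i).toNNReal).map
        (fun x => ∑ i, x i • hS.1.eigenvectorBasis i) := by
  set b := hS.1.eigenvectorBasis
  have := Measure.isProbabilityMeasure_map (μ := Measure.pi fun i =>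
    gaussianReal 0 (hS.1.eigenvalues i).toNNReal) (f := fun x => ∑ i, x i • b i)
    (Measurable.aemeasurable (by fun_prop))
  apply Measure.ext_of_charFun
  ext t
  rw [charFun_multivariateGaussian hS, charFun_apply,
    integral_map (Measurable.aemeasurable (by fun_prop))
      (Measurable.aestronglyMeasurable (by fun_prop))]
  simp_rw [sum_inner, Complex.ofReal_sum, Finset.sum_mul, Complex.exp_sum]
  rw [integral_fintype_prod_eq_prod
      (f := fun i (x : ℝ) ↦ Complex.exp ((inner ℝ (x • b i) t : ℝ) * Complex.I))]
  simp_rw [real_inner_smul_left, mul_comm _ (inner ℝ _ _), Complex.ofReal_mul,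
    ← charFun_apply_real, charFun_gaussianReal, ← Complex.exp_sum]
  congr 1
  have key : (t : ι → ℝ) ⬝ᵥ S *ᵥ t = ∑ i, hS.1.eigenvalues i * inner ℝ (b i) t ^ 2 := by
    have h0 : (t : ι → ℝ) ⬝ᵥ S *ᵥ t = inner ℝ (WithLp.toLp 2 (S *ᵥ t)) t := by
      simp [PiLp.inner_apply, dotProduct, mul_comm]
    rw [h0, ← b.sum_inner_mul_inner]
    refine Finset.sum_congr rfl fun i _ => ?_
    have h1 : inner ℝ (WithLp.toLp 2 (S *ᵥ t)) (b i) = (S *ᵥ (b i : ι → ℝ)) ⬝ᵥ (t : ι → ℝ) := by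
      have : inner ℝ (WithLp.toLp 2 (S *ᵥ t)) (b i) = (b i : ι → ℝ) ⬝ᵥ (S *ᵥ t) := by
        simp [PiLp.inner_apply, dotProduct]
      rw [this, dotProduct_mulVec, ← mulVec_transpose]
      have hT : Sᵀ = S := by simpa using hS.1.eq
      rw [hT]
    rw [h1, hS.1.mulVec_eigenvectorBasis]
    have h2 : inner ℝ (b i) t = (b i : ι → ℝ) ⬝ᵥ (t : ι → ℝ) := by
      simp [PiLp.inner_apply, dotProduct, mul_comm]
    rw [smul_dotProduct, h2, smul_eq_mul]
    ring
  simp only [inner_zero_right, Complex.ofReal_zero, zero_mul, mul_zero, zero_sub]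
  rw [key]
  push_cast
  rw [Finset.sum_div, ← Finset.sum_neg_distrib]
  refine Finset.sum_congr rfl fun i _ => ?_
  rw [Real.coe_toNNReal _ (hS.eigenvalues_nonneg i)]

/-- The law `N(0, S)` has a square integrable density with respect to `N(0, I)` as soon as all
eigenvalues of `S` lie strictly between `0` and `2`. -/
theorem hasSqDensity_multivariateGaussian {ι : Type*} [Fintype ι] [DecidableEq ι]
    {S : Matrix ι ι ℝ} (hS : S.PosSemidef) (h0 : ∀ i, 0 < hS.1.eigenvalues i)
    (h2 : ∀ i, hS.1.eigenvalues i < 2) :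
    HasSqDensity (multivariateGaussian 0 S) (stdGaussian (EuclideanSpace ℝ ι)) := by
  set b := hS.1.eigenvectorBasis
  rw [multivariateGaussian_eq_map_pi hS, stdGaussian_eq_map_pi_orthonormalBasis b]
  let e : (ι → ℝ) ≃ᵐ EuclideanSpace ℝ ι :=
    (MeasurableEquiv.toLp 2 (ι → ℝ)).trans b.repr.symm.toHomeomorph.toMeasurableEquiv
  have he : (fun x : ι → ℝ => ∑ i, x i • b i) = e := by
    ext1 x
    exact (b.sum_repr_symm (WithLp.toLp 2 x))
  rw [he]
  refine HasSqDensity.map (HasSqDensity.pi fun i => hasSqDensity_gaussianReal ?_ ?_) e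
  · simpa using h0 i
  · rw [Real.toNNReal_lt_iff_lt_coe (h0 i).le]; simpa using h2 i

/-! ### The generating function of multivariate Hermite polynomials -/

theorem sum_finsuppAntidiag_univ {κ M : Type*} [Fintype κ] [DecidableEq κ] [AddCommMonoid M]
    (N : ℕ) (g : (κ → ℕ) → M) :
    ∑ l ∈ Finset.finsuppAntidiag (Finset.univ : Finset κ) N, g l =
      ∑ w ∈ Finset.piAntidiag (Finset.univ : Finset κ) N, g w := by
  refine Finset.sum_bij' (fun l _ => ⇑l) (fun w _ => Finsupp.equivFunOnFinite.symm w) ?_ ?_ ?_ ?_ ?_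
  · intro l hl
    simpa using (Finset.mem_finsuppAntidiag.1 hl).1
  · intro w hw
    simpa [Finset.mem_finsuppAntidiag] using hw
  · intro l hl; ext; simp
  · intro w hw; ext; simp
  · intro l hl; rfl

open PowerSeries in
/-- The addition formula for Hermite polynomials. The exponential generating function of the Hermite
polynomials satisfies `F' = (a - b X) F`, hence so does a finite product of such series; comparing
coefficients gives the three-term recursion. -/
theorem sum_prod_hermite_eq_scaledHermite {κ : Type*} [Fintype κ] [DecidableEq κ]
    (l z : κ → ℝ) (N : ℕ) :
    ∑ w ∈ Finset.piAntidiag (Finset.univ : Finset κ) N,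
      ∏ k, (l k ^ w k / (w k).factorial * (realHermite (w k)).eval (z k)) =
      (scaledHermite (∑ k, l k ^ 2) N).eval (∑ k, l k * z k) := by
  let F : κ → PowerSeries ℝ := fun k =>
    PowerSeries.mk fun j => l k ^ j / j.factorial * (realHermite j).eval (z k)
  have hF : ∀ k, d⁄dX ℝ (F k) = (C (l k * z k) - C (l k ^ 2) * X) * F k := by
    intro k
    ext N
    rw [PowerSeries.coeff_derivative, sub_mul, map_sub, PowerSeries.coeff_C_mul, mul_assoc (C _) X,
      PowerSeries.coeff_C_mul]
    cases N with
    | zero => simp [F, realHermite_succ, realHermite_zero]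
    | succ N =>
      rw [mul_comm X, PowerSeries.coeff_succ_mul_X]
      simp only [F, PowerSeries.coeff_mk]
      rw [realHermite_add_two, Nat.factorial_succ, Nat.factorial_succ]
      have h1 : (N : ℝ) + 1 ≠ 0 := by positivity
      have h2 : (N : ℝ) + 1 + 1 ≠ 0 := by positivity
      simp only [Polynomial.eval_sub, Polynomial.eval_mul, Polynomial.eval_X, Polynomial.eval_C]
      push_cast
      field_simp
      ring
  have hprod : ∀ s : Finset κ, d⁄dX ℝ (∏ k ∈ s, F k) =
      (C (∑ k ∈ s, l k * z k) - C (∑ k ∈ s, l k ^ 2) * X) * ∏ k ∈ s, F k := by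
    intro s
    induction s using Finset.induction_on with
    | empty => simp
    | insert a s ha ih =>
      rw [Finset.prod_insert ha, Derivation.leibniz, ih, hF, Finset.sum_insert ha,
        Finset.sum_insert ha]
      simp only [smul_eq_mul, map_add]
      ring
  have hc : ∀ N, ∑ w ∈ Finset.piAntidiag (Finset.univ : Finset κ) N,
      ∏ k, (l k ^ w k / (w k).factorial * (realHermite (w k)).eval (z k)) =
      coeff N (∏ k, F k) := by
    intro N
    rw [PowerSeries.coeff_prod]
    simp only [F, PowerSeries.coeff_mk]
    exact (sum_finsuppAntidiag_univ N fun w => ∏ k, (l k ^ w k / (w k).factorial *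
      (realHermite (w k)).eval (z k))).symm
  have h0 : coeff 0 (∏ k, F k) = 1 := by
    rw [← hc]
    simp [realHermite_zero]
  rw [hc]
  refine eq_eval_scaledHermite (c := fun N => coeff N (∏ k, F k)) h0 ?_ ?_ N
  · have := congrArg (coeff 0) (hprod Finset.univ)
    rw [PowerSeries.coeff_derivative, sub_mul, map_sub, PowerSeries.coeff_C_mul, mul_assoc (C _) X,
      PowerSeries.coeff_C_mul, h0] at this
    simpa using this
  · intro N
    have := congrArg (coeff (N + 1)) (hprod Finset.univ)
    rw [PowerSeries.coeff_derivative, sub_mul, map_sub, PowerSeries.coeff_C_mul, mul_assoc (C _) X,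
      PowerSeries.coeff_C_mul, mul_comm X, PowerSeries.coeff_succ_mul_X] at this
    rw [← this]
    push_cast
    ring

/-- Two homogeneous polynomial functions that agree everywhere have the same coefficients. -/
theorem eq_of_sum_prod_pow_eq {κ : Type*} [Fintype κ] [DecidableEq κ] {N : ℕ}
    {c d : (κ → ℕ) → ℝ}
    (h : ∀ l : κ → ℝ, ∑ w ∈ Finset.piAntidiag (Finset.univ : Finset κ) N, (∏ k, l k ^ w k) * c w =
      ∑ w ∈ Finset.piAntidiag (Finset.univ : Finset κ) N, (∏ k, l k ^ w k) * d w)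
    {w : κ → ℕ} (hw : ∑ k, w k = N) : c w = d w := by
  let P : ((κ → ℕ) → ℝ) → MvPolynomial κ ℝ := fun c =>
    ∑ w ∈ Finset.piAntidiag (Finset.univ : Finset κ) N,
      MvPolynomial.monomial (Finsupp.equivFunOnFinite.symm w) (c w)
  have heval : ∀ c l, MvPolynomial.eval l (P c) =
      ∑ w ∈ Finset.piAntidiag (Finset.univ : Finset κ) N, (∏ k, l k ^ w k) * c w := by
    intro c l
    simp only [P, map_sum, MvPolynomial.eval_monomial]
    refine Finset.sum_congr rfl fun w _ => ?_
    rw [mul_comm, Finsupp.prod_fintype _ _ (by simp)]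
    simp
  have hcoeff : ∀ c, (P c).coeff (Finsupp.equivFunOnFinite.symm w) = c w := by
    intro c
    simp only [P, MvPolynomial.coeff_sum, MvPolynomial.coeff_monomial,
      EmbeddingLike.apply_eq_iff_eq]
    rw [Finset.sum_ite_eq' _ w]
    simp [hw]
  have hP : P c = P d := MvPolynomial.funext fun l => by rw [heval, heval, h l]
  rw [← hcoeff c, hP, hcoeff]

theorem sum_pow_div_factorial {κ : Type*} [Fintype κ] [DecidableEq κ] (y : κ → ℝ) (k : ℕ) :
    (∑ i, y i) ^ k / k.factorial =
      ∑ w ∈ Finset.piAntidiag (Finset.univ : Finset κ) k, ∏ a, (y a ^ w a / (w a).factorial) := by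
  rw [Finset.sum_pow_eq_sum_piAntidiag, Finset.sum_div]
  refine Finset.sum_congr rfl fun w hw => ?_
  have hs := Nat.multinomial_spec (Finset.univ : Finset κ) w
  rw [(Finset.mem_piAntidiag.1 hw).1] at hs
  have hs' : (∏ a, ((w a).factorial : ℝ)) * (Nat.multinomial Finset.univ w : ℝ) =
      (k.factorial : ℝ) := by exact_mod_cast hs
  have h1 : (∏ a, ((w a).factorial : ℝ)) ≠ 0 :=
    Finset.prod_ne_zero_iff.2 fun a _ => by positivity
  rw [Finset.prod_div_distrib, ← hs']
  have h2 : (Nat.multinomial Finset.univ w : ℝ) ≠ 0 := by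
    intro h; rw [h, mul_zero] at hs'; exact absurd hs'.symm (by positivity)
  field_simp

/-- The multinomial theorem in both blocks of variables at once. -/
theorem sum_balanced_prod_pow {ι κ : Type*} [Fintype ι] [Fintype κ] [DecidableEq ι]
    [DecidableEq κ] (x : ι ⊕ κ → ℝ) (k : ℕ) :
    ∑ w ∈ Finset.piAntidiag (Finset.univ : Finset (ι ⊕ κ)) (2 * k),
      (if ∑ i, w (Sum.inl i) = ∑ j, w (Sum.inr j) then
        ∏ a, (x a ^ w a / (w a).factorial) else 0) =
      (∑ i, x (Sum.inl i)) ^ k / k.factorial * ((∑ j, x (Sum.inr j)) ^ k / k.factorial) := by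
  rw [sum_pow_div_factorial, sum_pow_div_factorial, Finset.sum_mul_sum, ← Finset.sum_product',
    ← Finset.sum_filter]
  refine Finset.sum_bij' (fun w _ => (fun i => w (Sum.inl i), fun j => w (Sum.inr j)))
    (fun v _ => Sum.elim v.1 v.2) ?_ ?_ ?_ ?_ ?_
  · intro w hw
    simp only [Finset.mem_filter, Finset.mem_piAntidiag, Fintype.sum_sum_type, Finset.mem_univ,
      implies_true, and_true, Finset.mem_product] at hw ⊢
    omega
  · intro v hv
    simp only [Finset.mem_filter, Finset.mem_piAntidiag, Fintype.sum_sum_type, Finset.mem_univ,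
      implies_true, and_true, Finset.mem_product, Sum.elim_inl, Sum.elim_inr] at hv ⊢
    obtain ⟨h1, h2⟩ := hv
    have h1' : ∑ i, v.1 i = k := h1
    have h2' : ∑ j, v.2 j = k := h2
    omega
  · intro w hw
    ext a
    cases a <;> rfl
  · intro v hv
    rfl
  · intro w hw
    rw [Fintype.prod_sum_type]

/-! ### Hermite moments of a centred Gaussian vector -/

/-- The Hermite polynomial of one observation with degree index `w`, over an arbitrary finite set of
coordinates. -/
noncomputable def obsHermite {κ : Type*} [Fintype κ] (w : κ → ℕ) (z : EuclideanSpace ℝ κ) : ℝ :=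
  ∏ k, (realHermite (w k)).eval (z k)

theorem memLp_obsHermite {κ : Type*} [Fintype κ] (μ : Measure (EuclideanSpace ℝ κ)) [IsGaussian μ]
    (w : κ → ℕ) (r : ℝ≥0) : MemLp (obsHermite w) r μ := by
  have hcoord : ∀ k (r : ℝ≥0), MemLp (fun z : EuclideanSpace ℝ κ => z k) r μ := fun k r =>
    IsGaussian.memLp_dual μ (EuclideanSpace.proj k : EuclideanSpace ℝ κ →L[ℝ] ℝ) r
      ENNReal.coe_ne_top
  have hpow : ∀ k (d : ℕ) (r : ℝ≥0), MemLp (fun z : EuclideanSpace ℝ κ => z k ^ d) r μ := by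
    intro k d
    induction d with
    | zero => intro r; simpa using memLp_const (1 : ℝ)
    | succ d ih => intro r; simpa [pow_succ] using memLp_mul ih (hcoord k) r
  have hpoly : ∀ k (P : Polynomial ℝ) (r : ℝ≥0),
      MemLp (fun z : EuclideanSpace ℝ κ => P.eval (z k)) r μ := by
    intro k P
    induction P using Polynomial.induction_on' with
    | add P Q hP hQ =>
      intro r
      simp only [Polynomial.eval_add]
      exact (hP r).add (hQ r)
    | monomial d a =>
      intro r
      simpa [Polynomial.eval_monomial] using (hpow k d r).const_mul a
  have key : ∀ (S : Finset κ) (r : ℝ≥0),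
      MemLp (fun z : EuclideanSpace ℝ κ => ∏ k ∈ S, (realHermite (w k)).eval (z k)) r μ := by
    classical
    intro S
    induction S using Finset.induction_on with
    | empty => intro r; simpa using memLp_const (1 : ℝ)
    | insert a S ha ih =>
      intro r
      simpa [Finset.prod_insert ha] using memLp_mul (hpoly a _) ih r
  exact key Finset.univ r

theorem integrable_obsHermite {κ : Type*} [Fintype κ] (μ : Measure (EuclideanSpace ℝ κ))
    [IsGaussian μ] (w : κ → ℕ) : Integrable (obsHermite w) μ :=
  memLp_one_iff_integrable.1 (by exact_mod_cast memLp_obsHermite μ w 1)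

open Matrix in
theorem map_inner_multivariateGaussian {κ : Type*} [Fintype κ] [DecidableEq κ]
    {S : Matrix κ κ ℝ} (hS : S.PosSemidef) (l : κ → ℝ) :
    (multivariateGaussian 0 S).map (fun z => ∑ k, l k * z k) =
      gaussianReal 0 (l ⬝ᵥ S *ᵥ l).toNNReal := by
  have h1 : (fun z : EuclideanSpace ℝ κ => ∑ k, l k * z k) =
      innerSL ℝ (WithLp.toLp 2 l : EuclideanSpace ℝ κ) := by
    ext z
    simp [PiLp.inner_apply, mul_comm]
  rw [h1, IsGaussian.map_eq_gaussianReal, ContinuousLinearMap.integral_comp_id_comm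
    IsGaussian.integrable_id, integral_id_multivariateGaussian, map_zero]
  congr 2
  have h2 := covarianceBilin_multivariateGaussian (μ := 0) hS (WithLp.toLp 2 l) (WithLp.toLp 2 l)
  rw [covarianceBilin_self IsGaussian.memLp_two_id] at h2
  exact h2

open Matrix in
/-- The degree-`N` part of the exponential generating function of the Hermite moments of `N(0, S)`:
by the addition formula it is a moment of the single Gaussian variable `∑ k, l k * z k`. -/
theorem sum_integral_obsHermite {κ : Type*} [Fintype κ] [DecidableEq κ]
    {S : Matrix κ κ ℝ} (hS : S.PosSemidef) (l : κ → ℝ) (N : ℕ) :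
    ∑ w ∈ Finset.piAntidiag (Finset.univ : Finset κ) N,
      (∏ k, l k ^ w k) * ((∏ k, ((w k).factorial : ℝ))⁻¹ *
        ∫ z, obsHermite w z ∂multivariateGaussian 0 S) =
    ∫ x, (scaledHermite (∑ k, l k ^ 2) N).eval x ∂gaussianReal 0 (l ⬝ᵥ S *ᵥ l).toNNReal := by
  rw [← map_inner_multivariateGaussian hS, integral_map (Measurable.aemeasurable (by fun_prop))
    (by fun_prop)]
  simp_rw [← sum_prod_hermite_eq_scaledHermite]
  have : ∀ (w : κ → ℕ) (z : EuclideanSpace ℝ κ),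
      ∏ k, (l k ^ w k / (w k).factorial * (realHermite (w k)).eval (z k)) =
      ((∏ k, l k ^ w k) * (∏ k, ((w k).factorial : ℝ))⁻¹) * obsHermite w z := by
    intro w z
    rw [Finset.prod_mul_distrib, Finset.prod_div_distrib, div_eq_mul_inv]
    rfl
  simp_rw [this]
  rw [integral_finsetSum _ fun w _ => (integrable_obsHermite _ w).const_mul _]
  refine Finset.sum_congr rfl fun w _ => ?_
  rw [integral_const_mul]
  ring

/-! ### The cross-covariance model -/

section CovMatrix

variable {p q : ℕ} (α : EuclideanSpace ℝ (Fin p)) (β : EuclideanSpace ℝ (Fin q)) (ρ : ℝ)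

open Matrix in
theorem dotProduct_covMatrix_mulVec (l : Fin p ⊕ Fin q → ℝ) :
    l ⬝ᵥ covMatrix α β ρ *ᵥ l = ∑ k, l k ^ 2 +
      2 * (ρ * (∑ i, l (Sum.inl i) * α i) * (∑ j, l (Sum.inr j) * β j)) := by
  obtain ⟨a, b, rfl⟩ : ∃ a b, l = Sum.elim a b := ⟨_, _, (Sum.elim_comp_inl_inr l).symm⟩
  rw [covMatrix, fromBlocks_mulVec, dotProduct_comm]
  simp only [Sum.elim_comp_inl, Sum.elim_comp_inr, one_mulVec, smul_mulVec, vecMulVec_mulVec]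
  simp only [dotProduct, Fintype.sum_sum_type, Sum.elim_inl, Sum.elim_inr, Pi.add_apply,
    Pi.smul_apply, smul_eq_mul, MulOpposite.smul_eq_mul_unop, MulOpposite.unop_op, add_mul,
    Finset.sum_add_distrib]
  have e1 : ∑ x, ρ * (α x * ∑ i, β i * b i) * a x =
      ρ * (∑ i, a i * α i) * (∑ j, b j * β j) := by
    rw [mul_assoc, Finset.sum_mul, Finset.mul_sum]
    refine Finset.sum_congr rfl fun i _ => ?_
    simp_rw [mul_comm (β _)]
    ring
  have e2 : ∑ x, ρ * (β x * ∑ i, α i * a i) * b x =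
      ρ * (∑ i, a i * α i) * (∑ j, b j * β j) := by
    rw [mul_assoc, mul_comm (∑ i, a i * α i), Finset.sum_mul, Finset.mul_sum]
    refine Finset.sum_congr rfl fun i _ => ?_
    simp_rw [mul_comm (α _)]
    ring
  rw [e1, e2]
  simp only [pow_two]
  ring

theorem isHermitian_covMatrix : (covMatrix α β ρ).IsHermitian := by
  rw [Matrix.IsHermitian, covMatrix, Matrix.fromBlocks_conjTranspose]
  simp

/-- The off-diagonal part of the quadratic form is bounded by its operator norm `|ρ| ‖α‖ ‖β‖`. -/
theorem abs_two_mul_cross_le (l : Fin p ⊕ Fin q → ℝ) :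
    |2 * (ρ * (∑ i, l (Sum.inl i) * α i) * (∑ j, l (Sum.inr j) * β j))| ≤
      |ρ| * (‖α‖ * ‖β‖) * ∑ k, l k ^ 2 := by
  have hcs : ∀ {m : ℕ} (a : Fin m → ℝ) (γ : EuclideanSpace ℝ (Fin m)),
      |∑ i, a i * γ i| ≤ √(∑ i, a i ^ 2) * ‖γ‖ := by
    intro m a γ
    have := abs_real_inner_le_norm (WithLp.toLp 2 a) γ
    rw [EuclideanSpace.norm_eq (WithLp.toLp 2 a)] at this
    simpa [PiLp.inner_apply, mul_comm] using this
  have h1 := hcs (fun i => l (Sum.inl i)) α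
  have h2 := hcs (fun i => l (Sum.inr i)) β
  set A := ∑ i, l (Sum.inl i) ^ 2
  set B := ∑ i, l (Sum.inr i) ^ 2
  have hA : 0 ≤ A := Finset.sum_nonneg fun _ _ => sq_nonneg _
  have hB : 0 ≤ B := Finset.sum_nonneg fun _ _ => sq_nonneg _
  rw [Fintype.sum_sum_type, abs_mul, abs_mul, abs_mul, abs_two]
  have h3 : 2 * (√A * √B) ≤ A + B := by
    nlinarith [sq_nonneg (√A - √B), Real.sq_sqrt hA, Real.sq_sqrt hB]
  calc 2 * (|ρ| * |∑ i, l (Sum.inl i) * α i| * |∑ j, l (Sum.inr j) * β j|)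
      ≤ 2 * (|ρ| * (√A * ‖α‖) * (√B * ‖β‖)) := by gcongr
    _ = |ρ| * (‖α‖ * ‖β‖) * (2 * (√A * √B)) := by ring
    _ ≤ |ρ| * (‖α‖ * ‖β‖) * (A + B) := by gcongr

variable {α β ρ}

theorem posSemidef_covMatrix (h : |ρ| * (‖α‖ * ‖β‖) ≤ 1) : (covMatrix α β ρ).PosSemidef := by
  refine Matrix.PosSemidef.of_dotProduct_mulVec_nonneg (isHermitian_covMatrix α β ρ) fun l => ?_
  rw [star_trivial, dotProduct_covMatrix_mulVec]
  have h1 := abs_le.1 (abs_two_mul_cross_le α β ρ l)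
  have h2 : 0 ≤ ∑ k, l k ^ 2 := Finset.sum_nonneg fun _ _ => sq_nonneg _
  nlinarith [h1.1]

theorem hasSqDensity_covMatrix (h : |ρ| * (‖α‖ * ‖β‖) < 1) :
    HasSqDensity (multivariateGaussian 0 (covMatrix α β ρ)) (nullObs p q) := by
  have hS := posSemidef_covMatrix h.le
  have key : ∀ i, |hS.1.eigenvalues i - 1| ≤ |ρ| * (‖α‖ * ‖β‖) := by
    intro i
    have h1 := hS.1.eigenvalues_eq i
    have h2 : ∑ k, (hS.1.eigenvectorBasis i : Fin p ⊕ Fin q → ℝ) k ^ 2 = 1 := by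
      rw [← EuclideanSpace.real_norm_sq_eq, hS.1.eigenvectorBasis.orthonormal.1 i, one_pow]
    have h3 := abs_two_mul_cross_le α β ρ (hS.1.eigenvectorBasis i)
    rw [star_trivial, dotProduct_covMatrix_mulVec, h2] at h1
    rw [h2, mul_one] at h3
    rw [h1]
    simpa using h3
  refine hasSqDensity_multivariateGaussian hS (fun i => ?_) fun i => ?_
  · linarith [(abs_le.1 (key i)).1]
  · linarith [(abs_le.1 (key i)).2]

/-- The Hermite moments of one observation: comparing coefficients in the generating function
`exp (ρ ⟨a, α⟩ ⟨b, β⟩)`, only indices with equal degrees in both blocks survive. -/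
theorem integral_obsHermite_covMatrix (h : |ρ| * (‖α‖ * ‖β‖) ≤ 1) (w : Fin p ⊕ Fin q → ℕ) :
    ∫ z, obsHermite w z ∂multivariateGaussian 0 (covMatrix α β ρ) =
      if ∑ i, w (Sum.inl i) = ∑ j, w (Sum.inr j) then
        ρ ^ (∑ i, w (Sum.inl i)) * (∑ i, w (Sum.inl i)).factorial *
          ∏ k, (Sum.elim α β k) ^ w k
      else 0 := by
  have hS := posSemidef_covMatrix h
  have hfac : ∏ k, ((w k).factorial : ℝ) ≠ 0 :=
    Finset.prod_ne_zero_iff.2 fun a _ => by positivity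
  have hv : ∀ l : Fin p ⊕ Fin q → ℝ,
      (((l ⬝ᵥ (covMatrix α β ρ).mulVec l).toNNReal : ℝ) - ∑ k, l k ^ 2) / 2 =
      ρ * (∑ i, l (Sum.inl i) * α i) * (∑ j, l (Sum.inr j) * β j) := by
    intro l
    rw [Real.coe_toNNReal _ (by simpa using hS.dotProduct_mulVec_nonneg l),
      dotProduct_covMatrix_mulVec]
    ring
  rcases Nat.even_or_odd' (∑ k, w k) with ⟨d, hd | hd⟩
  · have := eq_of_sum_prod_pow_eq (N := 2 * d)
      (c := fun w => (∏ k, ((w k).factorial : ℝ))⁻¹ *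
        ∫ z, obsHermite w z ∂multivariateGaussian 0 (covMatrix α β ρ))
      (d := fun w => if ∑ i, w (Sum.inl i) = ∑ j, w (Sum.inr j) then
        ρ ^ d * d.factorial * ((∏ k, (Sum.elim α β k) ^ w k) * (∏ k, ((w k).factorial : ℝ))⁻¹)
        else 0) ?_ hd
    · simp only at this
      rw [inv_mul_eq_iff_eq_mul₀ hfac] at this
      rw [this]
      split_ifs with h1
      · rw [Fintype.sum_sum_type] at hd
        have h2 : ∑ i, w (Sum.inl i) = d := by omega
        rw [h2]
        field_simp
      · simp
    · intro l
      rw [sum_integral_obsHermite hS, integral_scaledHermite_even, hv]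
      have hb := sum_balanced_prod_pow (fun k => l k * Sum.elim α β k) d
      simp only [Sum.elim_inl, Sum.elim_inr] at hb
      have h1 : (ρ * (∑ i, l (Sum.inl i) * α i) * (∑ j, l (Sum.inr j) * β j)) ^ d / d.factorial =
          ρ ^ d * d.factorial * ((∑ i, l (Sum.inl i) * α i) ^ d / d.factorial *
            ((∑ j, l (Sum.inr j) * β j) ^ d / d.factorial)) := by
        have : (d.factorial : ℝ) ≠ 0 := by positivity
        rw [mul_pow, mul_pow]
        field_simp
      rw [h1, ← hb, Finset.mul_sum]
      refine Finset.sum_congr rfl fun w _ => ?_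
      split_ifs with h2
      · rw [Finset.prod_div_distrib]
        simp_rw [mul_pow]
        rw [Finset.prod_mul_distrib]
        ring
      · simp
  · have := eq_of_sum_prod_pow_eq (N := 2 * d + 1)
      (c := fun w => (∏ k, ((w k).factorial : ℝ))⁻¹ *
        ∫ z, obsHermite w z ∂multivariateGaussian 0 (covMatrix α β ρ))
      (d := fun w => 0) ?_ hd
    · rw [if_neg (by rw [Fintype.sum_sum_type] at hd; omega)]
      exact (mul_eq_zero.1 this).resolve_left (inv_ne_zero hfac)
    · intro l
      rw [sum_integral_obsHermite hS, integral_scaledHermite_odd]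
      simp

/-- The correlation of the degree-`N` parts of two single-observation likelihood ratios. -/
theorem sum_integral_obsHermite_mul {α' : EuclideanSpace ℝ (Fin p)}
    {β' : EuclideanSpace ℝ (Fin q)} {ρ' : ℝ} (h : |ρ| * (‖α‖ * ‖β‖) ≤ 1)
    (h' : |ρ'| * (‖α'‖ * ‖β'‖) ≤ 1) (N : ℕ) :
    ∑ w ∈ Finset.piAntidiag (Finset.univ : Finset (Fin p ⊕ Fin q)) N,
      (∫ z, obsHermite w z ∂multivariateGaussian 0 (covMatrix α β ρ)) *
      (∫ z, obsHermite w z ∂multivariateGaussian 0 (covMatrix α' β' ρ')) /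
        (∏ k, ((w k).factorial : ℝ)) =
    if 2 ∣ N then (ρ * ρ' * (∑ i, α i * α' i) * (∑ j, β j * β' j)) ^ (N / 2) else 0 := by
  split_ifs with hN
  · obtain ⟨d, rfl⟩ := hN
    rw [Nat.mul_div_cancel_left d (by norm_num)]
    have hb := sum_balanced_prod_pow (fun k => Sum.elim α β k * Sum.elim α' β' k) d
    simp only [Sum.elim_inl, Sum.elim_inr] at hb
    have h1 : (ρ * ρ' * (∑ i, α i * α' i) * (∑ j, β j * β' j)) ^ d =
        (ρ * ρ') ^ d * d.factorial ^ 2 * ((∑ i, α i * α' i) ^ d / d.factorial *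
          ((∑ j, β j * β' j) ^ d / d.factorial)) := by
      have : (d.factorial : ℝ) ≠ 0 := by positivity
      rw [mul_pow, mul_pow]
      field_simp
    rw [h1, ← hb, Finset.mul_sum]
    refine Finset.sum_congr rfl fun w hw => ?_
    rw [integral_obsHermite_covMatrix h, integral_obsHermite_covMatrix h']
    split_ifs with h2
    · have hd := (Finset.mem_piAntidiag.1 hw).1
      rw [Fintype.sum_sum_type] at hd
      have h3 : ∑ i, w (Sum.inl i) = d := by omega
      rw [h3, Finset.prod_div_distrib]
      simp_rw [mul_pow]
      rw [Finset.prod_mul_distrib]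
      ring
    · simp
  · refine Finset.sum_eq_zero fun w hw => ?_
    have hd := (Finset.mem_piAntidiag.1 hw).1
    rw [Fintype.sum_sum_type] at hd
    rw [integral_obsHermite_covMatrix h, if_neg (by omega)]
    simp

end CovMatrix

/-! ### Finitely supported measures -/

theorem eq_sum_smul_dirac {Ω : Type*} [MeasurableSpace Ω] [MeasurableSingletonClass Ω]
    {μ : Measure Ω} {F : Finset Ω} (h : ∀ᵐ x ∂μ, x ∈ F) :
    μ = ∑ a ∈ F, μ {a} • Measure.dirac a := by
  classical
  ext s hs
  have h1 : μ s = ∫⁻ x in (F : Set Ω), s.indicator 1 x ∂μ := by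
    rw [Measure.restrict_eq_self_of_ae_mem (s := (F : Set Ω)) h, lintegral_indicator_one hs]
  rw [h1, lintegral_finset]
  simp [hs, mul_comm]

theorem integral_sum_smul_dirac {Ω : Type*} [MeasurableSpace Ω] [MeasurableSingletonClass Ω]
    (F : Finset Ω) {c : Ω → ℝ≥0∞} (hc : ∀ a, c a ≠ ∞) (f : Ω → ℝ) :
    ∫ x, f x ∂(∑ a ∈ F, c a • Measure.dirac a) = ∑ a ∈ F, (c a).toReal * f a := by
  rw [integral_finsetSum_measure fun a _ => (integrable_dirac (by simp)).smul_measure (hc a)]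
  simp

/-- The weight of the point `a` under the sparse Rademacher prior, as a real number. -/
noncomputable def priorWeight (m s : ℕ) (a : EuclideanSpace ℝ (Fin m)) : ℝ := (prior m s).real {a}

theorem priorWeight_nonneg (m s : ℕ) (a : EuclideanSpace ℝ (Fin m)) : 0 ≤ priorWeight m s a :=
  measureReal_nonneg

/-- The support of the sparse Rademacher prior as a finite set. -/
noncomputable def priorFinset (m s : ℕ) : Finset (EuclideanSpace ℝ (Fin m)) :=
  (finite_priorSupport m s).toFinset

theorem prior_eq_sum (m s : ℕ) :
    prior m s = ∑ a ∈ priorFinset m s, prior m s {a} • Measure.dirac a :=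
  eq_sum_smul_dirac (by simpa [priorFinset] using ae_mem_priorSupport m s)

theorem integral_prior (m s : ℕ) (f : EuclideanSpace ℝ (Fin m) → ℝ) :
    ∫ x, f x ∂prior m s = ∑ a ∈ priorFinset m s, priorWeight m s a * f a := by
  conv_lhs => rw [prior_eq_sum]
  exact integral_sum_smul_dirac _ (fun a => measure_ne_top _ _) f

theorem isProbabilityMeasure_prior {m s : ℕ} (hs : 0 < s) (hsm : s ≤ m) :
    IsProbabilityMeasure (prior m s) := by
  have := isProbabilityMeasure_coordPrior hs hsm
  exact Measure.isProbabilityMeasure_map (Measurable.aemeasurable (by fun_prop))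

theorem sum_priorWeight {m s : ℕ} (hs : 0 < s) (hsm : s ≤ m) :
    ∑ a ∈ priorFinset m s, priorWeight m s a = 1 := by
  have := isProbabilityMeasure_prior hs hsm
  have h := integral_prior m s fun _ => 1
  simpa using h.symm

/-! ### Moments of the overlap of two independent draws from the prior -/

theorem integral_coordPrior {m s : ℕ} (hs : 0 < s) (hsm : s ≤ m) (f : ℝ → ℝ) :
    ∫ x, f x ∂coordPrior m s = s / (2 * m) * f (1 / √(s : ℝ)) + s / (2 * m) * f (-1 / √(s : ℝ)) +
      (1 - s / m) * f 0 := by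
  have hm : (0 : ℝ) < m := by exact_mod_cast hs.trans_le hsm
  have h1 : (s : ℝ) / m ≤ 1 := (div_le_one hm).2 (by exact_mod_cast hsm)
  have hi : ∀ (c a : ℝ), Integrable f (ENNReal.ofReal c • Measure.dirac a) := fun c a =>
    (integrable_dirac (by simp)).smul_measure ENNReal.ofReal_ne_top
  rw [coordPrior, integral_add_measure ((hi _ _).add_measure (hi _ _)) (hi _ _),
    integral_add_measure (hi _ _) (hi _ _)]
  simp only [integral_smul_measure, integral_dirac, smul_eq_mul]
  rw [ENNReal.toReal_ofReal (by positivity), ENNReal.toReal_ofReal (by linarith)]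

theorem integral_exp_coordPrior {m s : ℕ} (hs : 0 < s) (hsm : s ≤ m) (c : ℝ) :
    ∫ y, Real.exp (c * y) ∂coordPrior m s = 1 + s / m * (Real.cosh (c / √(s : ℝ)) - 1) := by
  have hm : (0 : ℝ) < m := by exact_mod_cast hs.trans_le hsm
  rw [integral_coordPrior hs hsm, Real.cosh_eq]
  have e1 : c * (1 / √(s : ℝ)) = c / √(s : ℝ) := by ring
  have e2 : c * (-1 / √(s : ℝ)) = -(c / √(s : ℝ)) := by ring
  rw [e1, e2, mul_zero, Real.exp_zero]
  field_simp
  ring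

theorem integral_integral_exp_coordPrior {m s : ℕ} (hs : 0 < s) (hsm : s ≤ m) (τ : ℝ) :
    ∫ x, ∫ y, Real.exp (τ * x * y) ∂coordPrior m s ∂coordPrior m s =
      1 + (s / m) ^ 2 * (Real.cosh (τ / s) - 1) := by
  have hm : (0 : ℝ) < m := by exact_mod_cast hs.trans_le hsm
  have hs' : (0 : ℝ) < s := by exact_mod_cast hs
  simp_rw [integral_exp_coordPrior hs hsm]
  rw [integral_coordPrior hs hsm]
  have hsq : √(s : ℝ) * √(s : ℝ) = s := Real.mul_self_sqrt hs'.le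
  have e1 : τ * (1 / √(s : ℝ)) / √(s : ℝ) = τ / s := by rw [mul_one_div, div_div, hsq]
  have e2 : τ * (-1 / √(s : ℝ)) / √(s : ℝ) = -(τ / s) := by
    rw [← mul_div_assoc, div_div, hsq]; ring
  rw [e1, e2, Real.cosh_neg]
  simp only [mul_zero, zero_div, Real.cosh_zero, sub_self]
  field_simp
  ring

/-- The moment generating function of the overlap `⟨a, a'⟩` of two independent draws. -/
theorem sum_priorWeight_exp {m s : ℕ} (hs : 0 < s) (hsm : s ≤ m) (τ : ℝ) :
    ∑ a ∈ priorFinset m s, ∑ a' ∈ priorFinset m s,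
      priorWeight m s a * priorWeight m s a' * Real.exp (τ * ∑ i, a i * a' i) =
      (1 + (s / m) ^ 2 * (Real.cosh (τ / s) - 1)) ^ m := by
  have := isProbabilityMeasure_coordPrior hs hsm
  have hpi : ∀ f : EuclideanSpace ℝ (Fin m) → ℝ, ∫ x, f x ∂prior m s =
      ∫ x : Fin m → ℝ, f (WithLp.toLp 2 x) ∂Measure.pi fun _ => coordPrior m s := by
    intro f
    rw [prior]
    exact integral_map_equiv (MeasurableEquiv.toLp 2 (Fin m → ℝ)) f
  have h1 : ∑ a ∈ priorFinset m s, ∑ a' ∈ priorFinset m s,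
      priorWeight m s a * priorWeight m s a' * Real.exp (τ * ∑ i, a i * a' i) =
      ∫ a, ∫ a', Real.exp (τ * ∑ i, a i * a' i) ∂prior m s ∂prior m s := by
    simp_rw [integral_prior, Finset.mul_sum, mul_assoc]
  rw [h1, ← integral_integral_exp_coordPrior hs hsm, hpi]
  simp_rw [hpi]
  have h2 : ∀ a : Fin m → ℝ,
      ∫ a' : Fin m → ℝ, Real.exp (τ * ∑ i, a i * a' i) ∂(Measure.pi fun _ => coordPrior m s) =
      ∏ i, ∫ y, Real.exp (τ * a i * y) ∂coordPrior m s := by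
    intro a
    rw [← integral_fintype_prod_eq_prod (fun i y => Real.exp (τ * a i * y))]
    refine integral_congr_ae (ae_of_all _ fun a' => ?_)
    simp only
    rw [← Real.exp_sum, Finset.mul_sum]
    simp_rw [mul_assoc]
  simp_rw [h2]
  rw [integral_fintype_prod_eq_prod (fun _ x => ∫ y, Real.exp (τ * x * y) ∂coordPrior m s)]
  simp

theorem sum_priorWeight_exp_le {m s : ℕ} (hs : 0 < s) (hsm : s ≤ m) {τ : ℝ} (hτ : |τ| ≤ s) :
    ∑ a ∈ priorFinset m s, ∑ a' ∈ priorFinset m s,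
      priorWeight m s a * priorWeight m s a' * Real.exp (τ * ∑ i, a i * a' i) ≤
      Real.exp (3 / 4 * τ ^ 2 / m) := by
  have hm : (0 : ℝ) < m := by exact_mod_cast hs.trans_le hsm
  have hs' : (0 : ℝ) < s := by exact_mod_cast hs
  rw [sum_priorWeight_exp hs hsm]
  have ht : (τ / s) ^ 2 ≤ 1 := by
    rw [sq_le_one_iff_abs_le_one, abs_div, abs_of_pos hs']
    exact (div_le_one hs').2 hτ
  have h1 : Real.cosh (τ / s) - 1 ≤ 3 / 4 * (τ / s) ^ 2 := by
    have h2 := Real.cosh_le_exp_half_sq (τ / s)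
    have h3 := (abs_le.1 (Real.abs_exp_sub_one_sub_id_le (x := (τ / s) ^ 2 / 2)
      (by rw [abs_of_nonneg (by positivity)]; linarith))).2
    nlinarith [sq_nonneg (τ / s)]
  have h0 : 0 ≤ Real.cosh (τ / s) - 1 := by linarith [Real.one_le_cosh (τ / s)]
  calc (1 + ((s : ℝ) / m) ^ 2 * (Real.cosh (τ / s) - 1)) ^ m
      ≤ (Real.exp ((s / m) ^ 2 * (3 / 4 * (τ / s) ^ 2))) ^ m := by
        gcongr
        calc 1 + ((s : ℝ) / m) ^ 2 * (Real.cosh (τ / s) - 1)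
            ≤ (s / m) ^ 2 * (3 / 4 * (τ / s) ^ 2) + 1 := by rw [add_comm]; gcongr
          _ ≤ _ := Real.add_one_le_exp _
    _ = Real.exp (3 / 4 * τ ^ 2 / m) := by
        rw [← Real.exp_nat_mul]
        congr 1
        field_simp

/-- A Chernoff-type bound on the absolute moments of the overlap. -/
theorem sum_priorWeight_abs_pow_le {m s : ℕ} (hs : 0 < s) (hsm : s ≤ m) {τ : ℝ} (hτ0 : 0 < τ)
    (hτ : τ ≤ s) (d : ℕ) :
    ∑ a ∈ priorFinset m s, ∑ a' ∈ priorFinset m s,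
      priorWeight m s a * priorWeight m s a' * |∑ i, a i * a' i| ^ d ≤
      2 * (d.factorial / τ ^ d) * Real.exp (3 / 4 * τ ^ 2 / m) := by
  have hpt : ∀ y : ℝ, |y| ^ d ≤ d.factorial / τ ^ d * (Real.exp (τ * y) + Real.exp (-τ * y)) := by
    intro y
    have h1 := Real.pow_div_factorial_le_exp (x := τ * |y|) (by positivity) d
    have h2 : Real.exp (τ * |y|) ≤ Real.exp (τ * y) + Real.exp (-τ * y) := by
      rcases abs_cases y with ⟨h, _⟩ | ⟨h, _⟩ <;> rw [h]
      · linarith [Real.exp_pos (-τ * y)]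
      · rw [mul_neg, ← neg_mul]; linarith [Real.exp_pos (τ * y)]
    have h3 := h1.trans h2
    rw [mul_pow, div_le_iff₀ (by positivity)] at h3
    rw [div_mul_eq_mul_div, le_div_iff₀ (by positivity)]
    linarith
  have h1 := sum_priorWeight_exp_le hs hsm (τ := τ) (by rwa [abs_of_pos hτ0])
  have h2 := sum_priorWeight_exp_le hs hsm (τ := -τ) (by rwa [abs_neg, abs_of_pos hτ0])
  rw [neg_sq] at h2
  calc ∑ a ∈ priorFinset m s, ∑ a' ∈ priorFinset m s,
      priorWeight m s a * priorWeight m s a' * |∑ i, a i * a' i| ^ d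
      ≤ ∑ a ∈ priorFinset m s, ∑ a' ∈ priorFinset m s,
        priorWeight m s a * priorWeight m s a' * (d.factorial / τ ^ d *
          (Real.exp (τ * ∑ i, a i * a' i) + Real.exp (-τ * ∑ i, a i * a' i))) := by
        gcongr with a _ a' _
        · exact mul_nonneg (priorWeight_nonneg _ _ _) (priorWeight_nonneg _ _ _)
        · exact hpt _
    _ = d.factorial / τ ^ d *
        (∑ a ∈ priorFinset m s, ∑ a' ∈ priorFinset m s,
          priorWeight m s a * priorWeight m s a' * Real.exp (τ * ∑ i, a i * a' i) +
        ∑ a ∈ priorFinset m s, ∑ a' ∈ priorFinset m s,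
          priorWeight m s a * priorWeight m s a' * Real.exp (-τ * ∑ i, a i * a' i)) := by
        simp_rw [mul_add, Finset.mul_sum, ← Finset.sum_add_distrib]
        refine Finset.sum_congr rfl fun a _ => Finset.sum_congr rfl fun a' _ => ?_
        ring
    _ ≤ d.factorial / τ ^ d * (Real.exp (3 / 4 * τ ^ 2 / m) + Real.exp (3 / 4 * τ ^ 2 / m)) := by
        gcongr
    _ = _ := by ring

/-! ### From one observation to the sample -/

theorem hermiteFun_eq_prod {n p q : ℕ} (w : Idx n p q → ℕ) (z : Sample n p q) :
    hermiteFun w z = ∏ i, obsHermite (fun k => w (i, k)) (z i) := by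
  simp only [hermiteFun, obsHermite, aeval_hermite]
  exact Fintype.prod_prod_type fun k : Idx n p q => (realHermite (w k)).eval (z k.1 k.2)

/-- Distributing the total degree over the observations. -/
theorem sum_piAntidiag_prod {ι κ : Type*} [Fintype ι] [Fintype κ] [DecidableEq ι]
    [DecidableEq κ] (c : (κ → ℕ) → ℝ) (N : ℕ) :
    ∑ w ∈ Finset.piAntidiag (Finset.univ : Finset (ι × κ)) N, ∏ i, c (fun k => w (i, k)) =
      ∑ l ∈ Finset.piAntidiag (Finset.univ : Finset ι) N,
        ∏ i, ∑ v ∈ Finset.piAntidiag (Finset.univ : Finset κ) (l i), c v := by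
  simp_rw [Finset.prod_univ_sum]
  rw [Finset.sum_sigma']
  refine Finset.sum_bij' (fun w _ => ⟨fun i => ∑ k, w (i, k), fun i k => w (i, k)⟩)
    (fun x _ a => x.2 a.1 a.2) ?_ ?_ ?_ ?_ ?_
  · intro w hw
    have h1 := (Finset.mem_piAntidiag.1 hw).1
    rw [Fintype.sum_prod_type] at h1
    simp [Fintype.mem_piFinset, h1]
  · rintro ⟨l, v⟩ hx
    simp only [Finset.mem_sigma, Finset.mem_piAntidiag, Finset.mem_univ, implies_true, and_true,
      Fintype.mem_piFinset] at hx ⊢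
    rw [Fintype.sum_prod_type, ← hx.1]
    exact Finset.sum_congr rfl fun i _ => hx.2 i
  · intro w hw
    rfl
  · rintro ⟨l, v⟩ hx
    simp only [Finset.mem_sigma, Finset.mem_piAntidiag, Finset.mem_univ, implies_true, and_true,
      Fintype.mem_piFinset] at hx
    have : (fun i => ∑ k, v i k) = l := funext fun i => hx.2 i
    subst this
    rfl
  · intro w hw
    rfl

theorem card_piAntidiag_univ {ι : Type*} [Fintype ι] [DecidableEq ι] (d : ℕ) :
    (Finset.piAntidiag (Finset.univ : Finset ι) d).card = (Fintype.card ι).multichoose d := by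
  have h := sum_finsuppAntidiag_univ (κ := ι) d fun _ => 1
  simp only [Finset.sum_const, smul_eq_mul, mul_one] at h
  rw [← h, Finset.card_finsuppAntidiag_nat_eq_multichoose, Finset.card_univ]

theorem sum_piAntidiag_even {ι : Type*} [Fintype ι] [DecidableEq ι] (x : ℝ) (N : ℕ) :
    ∑ l ∈ Finset.piAntidiag (Finset.univ : Finset ι) N,
      ∏ i, (if 2 ∣ l i then x ^ (l i / 2) else 0) =
    if 2 ∣ N then ((Fintype.card ι).multichoose (N / 2) : ℝ) * x ^ (N / 2) else 0 := by
  split_ifs with hN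
  · obtain ⟨d, rfl⟩ := hN
    rw [Nat.mul_div_cancel_left d (by norm_num)]
    have h1 : ∑ l ∈ Finset.piAntidiag (Finset.univ : Finset ι) (2 * d),
        ∏ i, (if 2 ∣ l i then x ^ (l i / 2) else 0) =
        ∑ l ∈ Finset.piAntidiag (Finset.univ : Finset ι) (2 * d) with ∀ i, 2 ∣ l i,
          ∏ i, (if 2 ∣ l i then x ^ (l i / 2) else 0) := by
      rw [Finset.sum_filter]
      refine Finset.sum_congr rfl fun l _ => ?_
      split_ifs with h
      · rfl
      · push Not at h
        obtain ⟨i, hi⟩ := h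
        exact Finset.prod_eq_zero (Finset.mem_univ i) (if_neg hi)
    rw [h1, ← Finset.map_nsmul_piAntidiag_univ d (by norm_num), Finset.sum_map,
      ← card_piAntidiag_univ, ← nsmul_eq_mul, ← Finset.sum_const]
    refine Finset.sum_congr rfl fun l hl => ?_
    have h2 : ∀ i, (if 2 ∣ 2 * l i then x ^ (2 * l i / 2) else 0) = x ^ l i := by
      intro i; simp
    simp only [Function.Embedding.coeFn_mk, Pi.smul_apply, smul_eq_mul, h2]
    rw [Finset.prod_pow_eq_pow_sum, (Finset.mem_piAntidiag.1 hl).1]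
  · refine Finset.sum_eq_zero fun l hl => ?_
    have h1 := (Finset.mem_piAntidiag.1 hl).1
    by_contra h
    have h2 : ∀ i, 2 ∣ l i := by
      intro i
      by_contra hi
      exact h (Finset.prod_eq_zero (Finset.mem_univ i) (if_neg hi))
    exact hN (h1 ▸ Finset.dvd_sum fun i _ => h2 i)

/-- The correlation strength of the law `altObs B α β`; the value `0` encodes the null law. -/
noncomputable def strength {p q : ℕ} (B : ℝ) (α : EuclideanSpace ℝ (Fin p))
    (β : EuclideanSpace ℝ (Fin q)) : ℝ :=
  open scoped Classical in if ‖α‖ * ‖β‖ < B then 1 / B else 0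

section

variable {p q : ℕ} {B : ℝ}

theorem abs_strength_mul_lt (hB : 0 < B) (α : EuclideanSpace ℝ (Fin p))
    (β : EuclideanSpace ℝ (Fin q)) : |strength B α β| * (‖α‖ * ‖β‖) < 1 := by
  unfold strength
  split_ifs with h
  · rw [abs_of_pos (by positivity), one_div_mul_eq_div, div_lt_one hB]
    exact h
  · simp

theorem abs_strength_le (hB : 0 < B) (α : EuclideanSpace ℝ (Fin p))
    (β : EuclideanSpace ℝ (Fin q)) : |strength B α β| ≤ 1 / B := by
  unfold strength
  split_ifs with h
  · rw [abs_of_pos (by positivity)]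
  · rw [abs_zero]; positivity

theorem covMatrix_zero (α : EuclideanSpace ℝ (Fin p)) (β : EuclideanSpace ℝ (Fin q)) :
    covMatrix α β 0 = 1 := by
  simp [covMatrix]

theorem nullObs_eq (p q : ℕ) : nullObs p q = multivariateGaussian 0 1 := by
  simp [nullObs]

theorem altObs_eq (B : ℝ) (α : EuclideanSpace ℝ (Fin p)) (β : EuclideanSpace ℝ (Fin q)) :
    altObs B α β = multivariateGaussian 0 (covMatrix α β (strength B α β)) := by
  unfold altObs strength
  split_ifs
  · rfl
  · rw [covMatrix_zero, nullObs_eq]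

instance isGaussian_altObs (B : ℝ) (α : EuclideanSpace ℝ (Fin p))
    (β : EuclideanSpace ℝ (Fin q)) : IsGaussian (altObs B α β) := by
  rw [altObs_eq]; infer_instance

instance isProbabilityMeasure_altSample (n : ℕ) (B : ℝ) (α : EuclideanSpace ℝ (Fin p))
    (β : EuclideanSpace ℝ (Fin q)) : IsProbabilityMeasure (altSample n B α β) := by
  unfold altSample; infer_instance

theorem hasSqDensity_altSample (n : ℕ) (hB : 0 < B) (α : EuclideanSpace ℝ (Fin p))
    (β : EuclideanSpace ℝ (Fin q)) :
    HasSqDensity (altSample n B α β) (nullSample n p q) := by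
  refine HasSqDensity.pi fun _ => ?_
  rw [altObs_eq]
  exact hasSqDensity_covMatrix (abs_strength_mul_lt hB α β)

theorem integrable_hermiteFun_altSample {n : ℕ} (α : EuclideanSpace ℝ (Fin p))
    (β : EuclideanSpace ℝ (Fin q)) (w : Idx n p q → ℕ) :
    Integrable (hermiteFun w) (altSample n B α β) := by
  have h := Integrable.fintype_prod_dep (μ := fun _ : Fin n => altObs B α β)
    (f := fun i => obsHermite fun k => w (i, k)) fun i => integrable_obsHermite _ _
  refine h.congr (ae_of_all _ fun z => ?_)
  simp only [hermiteFun_eq_prod]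

theorem integral_hermiteFun_altSample {n : ℕ} (α : EuclideanSpace ℝ (Fin p))
    (β : EuclideanSpace ℝ (Fin q)) (w : Idx n p q → ℕ) :
    ∫ z, hermiteFun w z ∂altSample n B α β =
      ∏ i, ∫ z, obsHermite (fun k => w (i, k)) z ∂altObs B α β := by
  simp_rw [hermiteFun_eq_prod]
  exact integral_fintype_prod_eq_prod _

/-- The correlation, in total degree `N`, of the likelihood ratios of two samples. -/
theorem sum_integral_hermiteFun_mul (hB : 0 < B) (n : ℕ) (α α' : EuclideanSpace ℝ (Fin p))
    (β β' : EuclideanSpace ℝ (Fin q)) (N : ℕ) :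
    ∑ w ∈ Finset.piAntidiag (Finset.univ : Finset (Idx n p q)) N,
      (∫ z, hermiteFun w z ∂altSample n B α β) * (∫ z, hermiteFun w z ∂altSample n B α' β') /
        (∏ k, ((w k).factorial : ℝ)) =
    if 2 ∣ N then (n.multichoose (N / 2) : ℝ) * (strength B α β * strength B α' β' *
      (∑ i, α i * α' i) * (∑ j, β j * β' j)) ^ (N / 2) else 0 := by
  have h := sum_piAntidiag_even (ι := Fin n) (strength B α β * strength B α' β' *
      (∑ i, α i * α' i) * (∑ j, β j * β' j)) N
  rw [Fintype.card_fin] at h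
  rw [← h]
  simp_rw [← sum_integral_obsHermite_mul (abs_strength_mul_lt hB α β).le
    (abs_strength_mul_lt hB α' β').le, ← altObs_eq]
  rw [← sum_piAntidiag_prod (fun v => (∫ z, obsHermite v z ∂altObs B α β) *
    (∫ z, obsHermite v z ∂altObs B α' β') / (∏ k, ((v k).factorial : ℝ)))]
  refine Finset.sum_congr rfl fun w _ => ?_
  rw [integral_hermiteFun_altSample, integral_hermiteFun_altSample, Fintype.prod_prod_type,
    ← Finset.prod_mul_distrib, ← Finset.prod_div_distrib]

end

/-! ### Orthogonality of the Hermite polynomials and the low-degree projection -/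

theorem integral_obsHermite_mul {p q : ℕ} (w w' : Fin p ⊕ Fin q → ℕ) :
    ∫ z, obsHermite w z * obsHermite w' z ∂nullObs p q =
      if w = w' then ∏ k, ((w k).factorial : ℝ) else 0 := by
  have h1 : ∫ z, obsHermite w z * obsHermite w' z ∂nullObs p q =
      ∫ x : Fin p ⊕ Fin q → ℝ, ∏ k, ((realHermite (w k)).eval (x k) *
        (realHermite (w' k)).eval (x k)) ∂Measure.pi fun _ => gaussianReal 0 1 := by
    rw [nullObs, ← map_pi_eq_stdGaussian]
    refine (integral_map_equiv (MeasurableEquiv.toLp 2 (Fin p ⊕ Fin q → ℝ)) _).trans ?_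
    refine integral_congr_ae (ae_of_all _ fun x => ?_)
    exact Finset.prod_mul_distrib.symm
  rw [h1, integral_fintype_prod_eq_prod (fun k x => (realHermite (w k)).eval x *
        (realHermite (w' k)).eval x)]
  simp_rw [integral_realHermite_mul]
  split_ifs with h
  · subst h; simp
  · obtain ⟨k, hk⟩ := Function.ne_iff.1 h
    exact Finset.prod_eq_zero (Finset.mem_univ k) (if_neg hk)

theorem integral_hermiteFun_mul {n p q : ℕ} (w w' : Idx n p q → ℕ) :
    ∫ z, hermiteFun w z * hermiteFun w' z ∂nullSample n p q =
      if w = w' then ∏ k, ((w k).factorial : ℝ) else 0 := by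
  simp_rw [hermiteFun_eq_prod, ← Finset.prod_mul_distrib]
  rw [nullSample, integral_fintype_prod_eq_prod (fun i z =>
    obsHermite (fun k => w (i, k)) z * obsHermite (fun k => w' (i, k)) z)]
  simp_rw [integral_obsHermite_mul]
  split_ifs with h
  · subst h; simp [Fintype.prod_prod_type]
  · obtain ⟨k, hk⟩ := Function.ne_iff.1 h
    refine Finset.prod_eq_zero (Finset.mem_univ k.1) (if_neg fun h' => hk ?_)
    exact congrFun h' k.2

theorem inner_hermiteL2 {n p q : ℕ} (w w' : Idx n p q → ℕ) :
    inner ℝ (hermiteL2 w) (hermiteL2 w') =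
      if w = w' then ∏ k, ((w k).factorial : ℝ) else 0 := by
  rw [← integral_hermiteFun_mul, L2.inner_def]
  refine integral_congr_ae ?_
  filter_upwards [(memLp_hermiteFun w).coeFn_toLp, (memLp_hermiteFun w').coeFn_toLp] with z h1 h2
  rw [hermiteL2, hermiteL2, h1, h2]
  simp [mul_comm]

/-- The squared norm of the projection onto the span of a finite orthogonal family. -/
theorem norm_sq_starProjection_span {E ι : Type*} [NormedAddCommGroup E] [InnerProductSpace ℝ E]
    [DecidableEq ι] (W : Finset ι) (v : ι → E) (c : ι → ℝ) (hc : ∀ w, c w ≠ 0)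
    (hv : ∀ w w', inner ℝ (v w) (v w') = if w = w' then c w else 0)
    (K : Submodule ℝ E) [K.HasOrthogonalProjection] (hK : K = Submodule.span ℝ (v '' W)) (f : E) :
    ‖K.starProjection f‖ ^ 2 = ∑ w ∈ W, inner ℝ (v w) f ^ 2 / c w := by
  have hproj : K.starProjection f = ∑ w ∈ W, (inner ℝ (v w) f / c w) • v w := by
    refine Submodule.eq_starProjection_of_mem_of_inner_eq_zero ?_ ?_
    · rw [hK]
      exact Submodule.sum_mem _ fun w hw => Submodule.smul_mem _ _
        (Submodule.subset_span ⟨w, hw, rfl⟩)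
    · intro u hu
      rw [hK] at hu
      induction hu using Submodule.span_induction with
      | mem u hu =>
        obtain ⟨w, hw, rfl⟩ := hu
        rw [inner_sub_left, sum_inner]
        simp_rw [real_inner_smul_left, hv]
        rw [real_inner_comm]
        have hw' : w ∈ W := hw
        simp [hw', hc w]
      | zero => simp
      | add x y _ _ hx hy => rw [inner_add_right, hx, hy, add_zero]
      | smul a x _ hx => rw [inner_smul_right, hx, mul_zero]
  rw [hproj, ← real_inner_self_eq_norm_sq, sum_inner]
  refine Finset.sum_congr rfl fun w hw => ?_
  rw [inner_sum]
  simp_rw [real_inner_smul_left, real_inner_smul_right, hv]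
  have := hc w
  simp only [mul_ite, mul_zero, Finset.sum_ite_eq, hw, if_true]
  field_simp

/-- The squared norm of the low-degree part, as a sum of squared Hermite coefficients. -/
theorem norm_sq_lowDegProj {n p q : ℕ} (D : ℕ) (f : Lp ℝ 2 (nullSample n p q)) :
    ‖lowDegProj D f‖ ^ 2 = ∑ N ∈ Finset.range (D + 1),
      ∑ w ∈ Finset.piAntidiag (Finset.univ : Finset (Idx n p q)) N,
        inner ℝ (hermiteL2 w) f ^ 2 / ∏ k, ((w k).factorial : ℝ) := by
  have hdisj : ∀ N ∈ Finset.range (D + 1), ∀ N' ∈ Finset.range (D + 1), N ≠ N' →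
      Disjoint (Finset.piAntidiag (Finset.univ : Finset (Idx n p q)) N)
        (Finset.piAntidiag (Finset.univ : Finset (Idx n p q)) N') := by
    intro N _ N' _ hNN'
    rw [Finset.disjoint_left]
    intro w h1 h2
    exact hNN' ((Finset.mem_piAntidiag.1 h1).1.symm.trans (Finset.mem_piAntidiag.1 h2).1)
  rw [lowDegProj, ← Finset.sum_biUnion hdisj]
  refine norm_sq_starProjection_span _ hermiteL2 (fun w => ∏ k, ((w k).factorial : ℝ))
    (fun w => Finset.prod_ne_zero_iff.2 fun a _ => by positivity) inner_hermiteL2 _ ?_ f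
  rw [lowDegSpace]
  congr 2
  ext w
  simp

/-! ### The mixture and its Hermite coefficients -/

theorem jointPrior_eq_sum (p q sx sy : ℕ) :
    jointPrior p q sx sy = ∑ u ∈ priorFinset p sx ×ˢ priorFinset q sy,
      jointPrior p q sx sy {u} • Measure.dirac u := by
  refine eq_sum_smul_dirac ?_
  have h1 := Measure.quasiMeasurePreserving_fst.ae
    (μa := (prior p sx).prod (prior q sy)) (ae_mem_priorSupport p sx)
  have h2 := Measure.quasiMeasurePreserving_snd.ae
    (μa := (prior p sx).prod (prior q sy)) (ae_mem_priorSupport q sy)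
  filter_upwards [h1, h2] with x hx1 hx2
  simpa [priorFinset] using ⟨hx1, hx2⟩

instance (p q sx sy : ℕ) : IsFiniteMeasure (jointPrior p q sx sy) := by
  unfold jointPrior; infer_instance

theorem toReal_jointPrior_singleton (p q sx sy : ℕ)
    (u : EuclideanSpace ℝ (Fin p) × EuclideanSpace ℝ (Fin q)) :
    (jointPrior p q sx sy {u}).toReal = priorWeight p sx u.1 * priorWeight q sy u.2 := by
  rw [jointPrior, ← Prod.mk.eta (p := u), ← Set.singleton_prod_singleton, Measure.prod_prod,
    ENNReal.toReal_mul]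
  rfl

theorem mixture_eq_sum (n p q sx sy : ℕ) (B : ℝ) :
    mixture n p q sx sy B = ∑ u ∈ priorFinset p sx ×ˢ priorFinset q sy,
      jointPrior p q sx sy {u} • altSample n B u.1 u.2 := by
  ext s hs
  rw [mixture, Measure.bind_apply hs (aemeasurable_jointPrior sx sy _)]
  conv_lhs => rw [jointPrior_eq_sum]
  rw [lintegral_finsetSum_measure]
  simp

theorem hasSqDensity_mixture (n p q sx sy : ℕ) {B : ℝ} (hB : 0 < B) :
    HasSqDensity (mixture n p q sx sy B) (nullSample n p q) := by
  rw [mixture_eq_sum]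
  exact HasSqDensity.sum _ fun u _ =>
    (hasSqDensity_altSample n hB u.1 u.2).smul (measure_ne_top _ _)

instance (n p q sx sy : ℕ) (B : ℝ) : IsFiniteMeasure (mixture n p q sx sy B) := by
  rw [mixture_eq_sum]
  constructor
  simp [measure_lt_top]

theorem integral_hermiteFun_mixture {n p q sx sy : ℕ} {B : ℝ} (w : Idx n p q → ℕ) :
    ∫ z, hermiteFun w z ∂mixture n p q sx sy B =
      ∑ u ∈ priorFinset p sx ×ˢ priorFinset q sy,
        priorWeight p sx u.1 * priorWeight q sy u.2 *
          ∫ z, hermiteFun w z ∂altSample n B u.1 u.2 := by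
  rw [mixture_eq_sum, integral_finsetSum_measure fun u _ =>
    (integrable_hermiteFun_altSample u.1 u.2 w).smul_measure (measure_ne_top _ _)]
  refine Finset.sum_congr rfl fun u _ => ?_
  rw [integral_smul_measure, toReal_jointPrior_singleton, smul_eq_mul]

theorem inner_hermiteL2_likelihoodRatio {n p q sx sy : ℕ} {B : ℝ} (hB : 0 < B)
    (h : MemLp (likelihoodRatio n p q sx sy B) 2 (nullSample n p q)) (w : Idx n p q → ℕ) :
    inner ℝ (hermiteL2 w) (h.toLp (likelihoodRatio n p q sx sy B)) =
      ∫ z, hermiteFun w z ∂mixture n p q sx sy B := by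
  rw [← integral_rnDeriv_smul (hasSqDensity_mixture n p q sx sy hB).absolutelyContinuous,
    L2.inner_def]
  refine integral_congr_ae ?_
  filter_upwards [(memLp_hermiteFun w).coeFn_toLp, h.coeFn_toLp] with z h1 h2
  rw [hermiteL2, h1, h2]
  simp [likelihoodRatio]

/-- The contribution of each degree to the squared norm, expressed through the overlaps of two
independent draws of the parameters. -/
theorem sum_sq_integral_hermiteFun_mixture {n p q sx sy : ℕ} {B : ℝ} (hB : 0 < B) (N : ℕ) :
    ∑ w ∈ Finset.piAntidiag (Finset.univ : Finset (Idx n p q)) N,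
      (∫ z, hermiteFun w z ∂mixture n p q sx sy B) ^ 2 / ∏ k, ((w k).factorial : ℝ) =
    ∑ u ∈ priorFinset p sx ×ˢ priorFinset q sy, ∑ u' ∈ priorFinset p sx ×ˢ priorFinset q sy,
      (priorWeight p sx u.1 * priorWeight q sy u.2) *
      (priorWeight p sx u'.1 * priorWeight q sy u'.2) *
      if 2 ∣ N then (n.multichoose (N / 2) : ℝ) * (strength B u.1 u.2 * strength B u'.1 u'.2 *
        (∑ i, u.1 i * u'.1 i) * (∑ j, u.2 j * u'.2 j)) ^ (N / 2) else 0 := by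
  simp_rw [← sum_integral_hermiteFun_mul hB n, integral_hermiteFun_mixture, sq,
    Finset.sum_mul_sum, Finset.sum_div, Finset.mul_sum]
  rw [Finset.sum_comm]
  refine Finset.sum_congr rfl fun u _ => ?_
  rw [Finset.sum_comm]
  refine Finset.sum_congr rfl fun u' _ => Finset.sum_congr rfl fun w _ => ?_
  ring

theorem sum_sq_integral_hermiteFun_mixture_odd {n p q sx sy : ℕ} {B : ℝ} (hB : 0 < B) {N : ℕ}
    (hN : ¬ 2 ∣ N) :
    ∑ w ∈ Finset.piAntidiag (Finset.univ : Finset (Idx n p q)) N,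
      (∫ z, hermiteFun w z ∂mixture n p q sx sy B) ^ 2 / ∏ k, ((w k).factorial : ℝ) = 0 := by
  rw [sum_sq_integral_hermiteFun_mixture hB]
  simp [hN]

/-- Absolute values remove the truncation and decouple the overlaps of the two blocks. -/
theorem sum_sq_integral_hermiteFun_mixture_even_le {n p q sx sy : ℕ} {B : ℝ} (hB : 0 < B)
    (d : ℕ) :
    ∑ w ∈ Finset.piAntidiag (Finset.univ : Finset (Idx n p q)) (2 * d),
      (∫ z, hermiteFun w z ∂mixture n p q sx sy B) ^ 2 / ∏ k, ((w k).factorial : ℝ) ≤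
    (n.multichoose d : ℝ) * (1 / B ^ 2) ^ d *
      ((∑ a ∈ priorFinset p sx, ∑ a' ∈ priorFinset p sx,
        priorWeight p sx a * priorWeight p sx a' * |∑ i, a i * a' i| ^ d) *
      (∑ b ∈ priorFinset q sy, ∑ b' ∈ priorFinset q sy,
        priorWeight q sy b * priorWeight q sy b' * |∑ j, b j * b' j| ^ d)) := by
  rw [sum_sq_integral_hermiteFun_mixture hB]
  simp only [dvd_mul_right, if_true, Nat.mul_div_cancel_left d (zero_lt_two)]
  have hpt : ∀ u u' : EuclideanSpace ℝ (Fin p) × EuclideanSpace ℝ (Fin q),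
      (strength B u.1 u.2 * strength B u'.1 u'.2 *
        (∑ i, u.1 i * u'.1 i) * (∑ j, u.2 j * u'.2 j)) ^ d ≤
      (1 / B ^ 2) ^ d * (|∑ i, u.1 i * u'.1 i| ^ d * |∑ j, u.2 j * u'.2 j| ^ d) := by
    intro u u'
    refine (le_abs_self _).trans ?_
    rw [abs_pow, abs_mul, abs_mul, abs_mul, ← mul_pow, ← mul_pow, ← mul_assoc]
    gcongr
    calc |strength B u.1 u.2| * |strength B u'.1 u'.2| ≤ 1 / B * (1 / B) := by
          gcongr <;> exact abs_strength_le hB _ _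
      _ = 1 / B ^ 2 := by ring
  calc _ ≤ ∑ u ∈ priorFinset p sx ×ˢ priorFinset q sy,
        ∑ u' ∈ priorFinset p sx ×ˢ priorFinset q sy,
        (priorWeight p sx u.1 * priorWeight q sy u.2) *
        (priorWeight p sx u'.1 * priorWeight q sy u'.2) *
        ((n.multichoose d : ℝ) * ((1 / B ^ 2) ^ d *
          (|∑ i, u.1 i * u'.1 i| ^ d * |∑ j, u.2 j * u'.2 j| ^ d))) := by
        gcongr with u _ u' _
        · have h := priorWeight_nonneg p sx
          have h' := priorWeight_nonneg q sy
          exact mul_nonneg (mul_nonneg (h _) (h' _)) (mul_nonneg (h _) (h' _))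
        · exact hpt u u'
    _ = _ := by
        simp_rw [Finset.sum_product]
        rw [Finset.sum_mul_sum, Finset.mul_sum]
        refine Finset.sum_congr rfl fun a _ => ?_
        rw [Finset.mul_sum]
        refine Finset.sum_congr rfl fun b _ => ?_
        rw [Finset.sum_mul_sum, Finset.mul_sum]
        refine Finset.sum_congr rfl fun a' _ => ?_
        rw [Finset.mul_sum]
        refine Finset.sum_congr rfl fun b' _ => ?_
        ring

/-! ### The uniform bound -/

theorem multichoose_mul_factorial_le {n : ℕ} (hn : 0 < n) (d : ℕ) :
    ((n.multichoose d : ℕ) : ℝ) * d.factorial ≤ ((n : ℝ) + d) ^ d := by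
  have h : n.multichoose d * d.factorial ≤ (n + d) ^ d := by
    rw [Nat.multichoose_eq, mul_comm, ← Nat.ascFactorial_eq_factorial_mul_choose']
    calc n.ascFactorial d ≤ (n + d - 1) ^ d := by
          obtain ⟨k, rfl⟩ : ∃ k, n = k + 1 := ⟨n - 1, by omega⟩
          rw [show k + 1 + d - 1 = k + d by omega]
          exact Nat.ascFactorial_le_pow_add k d
      _ ≤ (n + d) ^ d := Nat.pow_le_pow_left (by omega) d
  exact_mod_cast h

/-- Each even degree `2 * d` contributes at most a term of a fixed geometric series. -/
theorem sum_sq_integral_hermiteFun_mixture_le {n p q sx sy D : ℕ} {B : ℝ} (hB : 0 < B)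
    (hsx : 0 < sx) (hsxp : sx ≤ p) (hsy : 0 < sy) (hsyq : sy ≤ q) (hDn : D ≤ n)
    (hx : √(Real.exp 1 * n * D) / B ≤ sx) (hy : √(Real.exp 1 * n * D) / B ≤ sy)
    (hp : 3 * Real.exp 1 * n / B ^ 2 ≤ p) (hq : 3 * Real.exp 1 * n / B ^ 2 ≤ q)
    {d : ℕ} (hd : 2 * d ≤ D) :
    ∑ w ∈ Finset.piAntidiag (Finset.univ : Finset (Idx n p q)) (2 * d),
      (∫ z, hermiteFun w z ∂mixture n p q sx sy B) ^ 2 / ∏ k, ((w k).factorial : ℝ) ≤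
    4 * (3 / 4 : ℝ) ^ d := by
  refine (sum_sq_integral_hermiteFun_mixture_even_le hB d).trans ?_
  -- Degree zero is separate: the moment bound needs `τ > 0`, and `τ` below vanishes for `d = 0`.
  rcases Nat.eq_zero_or_pos d with rfl | hd0
  · simp only [pow_zero, mul_one, ← Finset.mul_sum, sum_priorWeight hsx hsxp,
      sum_priorWeight hsy hsyq, Nat.multichoose_zero_right]
    norm_num
  have hn : 0 < n := by omega
  have he := Real.exp_pos 1
  have hn' : (0 : ℝ) < n := by exact_mod_cast hn
  have hd' : (0 : ℝ) < d := by exact_mod_cast hd0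
  have hdD : 2 * (d : ℝ) ≤ D := by exact_mod_cast hd
  have hdn : 2 * (d : ℝ) ≤ n := by exact_mod_cast hd.trans hDn
  -- With this choice of `τ` the exponential factors in the moment bounds are at most `exp (d / 2)`.
  set τ := √(2 * d * (Real.exp 1 * n / B ^ 2)) with hτ
  have hτsq : τ ^ 2 = 2 * d * (Real.exp 1 * n / B ^ 2) := Real.sq_sqrt (by positivity)
  have hτ0 : 0 < τ := Real.sqrt_pos.2 (by positivity)
  have hτle : τ ≤ √(Real.exp 1 * n * D) / B := by
    rw [hτ]
    refine Real.sqrt_le_iff.2 ⟨by positivity, ?_⟩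
    rw [div_pow, Real.sq_sqrt (by positivity), ← mul_div_assoc, mul_comm (2 * (d : ℝ))]
    gcongr
  have hmom : ∀ {m s : ℕ}, 0 < s → s ≤ m → √(Real.exp 1 * n * D) / B ≤ s →
      3 * Real.exp 1 * n / B ^ 2 ≤ m →
      ∑ a ∈ priorFinset m s, ∑ a' ∈ priorFinset m s,
        priorWeight m s a * priorWeight m s a' * |∑ i, a i * a' i| ^ d ≤
      2 * (d.factorial / τ ^ d) * Real.exp (d / 2) := by
    intro m s hs hsm h1 h2
    have hm : (0 : ℝ) < m := by exact_mod_cast hs.trans_le hsm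
    refine (sum_priorWeight_abs_pow_le hs hsm hτ0 (hτle.trans h1) d).trans ?_
    refine mul_le_mul_of_nonneg_left (Real.exp_le_exp.2 ?_) (by positivity)
    rw [hτsq, div_le_iff₀ hm]
    calc 3 / 4 * (2 * d * (Real.exp 1 * n / B ^ 2))
        = (d : ℝ) / 2 * (3 * Real.exp 1 * n / B ^ 2) := by ring
      _ ≤ (d : ℝ) / 2 * m := by gcongr
  calc _ ≤ (n.multichoose d : ℝ) * (1 / B ^ 2) ^ d *
        ((2 * (d.factorial / τ ^ d) * Real.exp (d / 2)) *
          (2 * (d.factorial / τ ^ d) * Real.exp (d / 2))) := by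
        have hnn : ∀ {m s : ℕ}, 0 ≤ ∑ a ∈ priorFinset m s, ∑ a' ∈ priorFinset m s,
            priorWeight m s a * priorWeight m s a' * |∑ i, a i * a' i| ^ d := fun {m s} =>
          Finset.sum_nonneg fun a _ => Finset.sum_nonneg fun a' _ =>
            mul_nonneg (mul_nonneg (priorWeight_nonneg _ _ _) (priorWeight_nonneg _ _ _))
              (by positivity)
        gcongr
        · exact hnn
        · exact hmom hsx hsxp hx hp
        · exact hmom hsy hsyq hy hq
    _ = 4 * (((n.multichoose d : ℝ) * d.factorial) * d.factorial * (1 / (2 * d * n)) ^ d) := by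
        have h1 : Real.exp (d / 2) * Real.exp (d / 2) = Real.exp 1 ^ d := by
          rw [← Real.exp_add, ← Real.exp_nat_mul]; ring_nf
        have h2 : τ ^ d * τ ^ d = (2 * d * (Real.exp 1 * n / B ^ 2)) ^ d := by
          rw [← mul_pow, ← sq, hτsq]
        have h3 : (1 / (2 * (d : ℝ) * n)) ^ d =
            (1 / B ^ 2) ^ d * (Real.exp 1 ^ d / (2 * d * (Real.exp 1 * n / B ^ 2)) ^ d) := by
          rw [← div_pow, ← mul_pow]
          congr 1
          field_simp
        rw [h3, ← h1, ← h2]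
        field_simp
        ring
    _ ≤ 4 * (((3 / 2 * n) ^ d) * (d : ℝ) ^ d * (1 / (2 * d * n)) ^ d) := by
        have h1 : (n.multichoose d : ℝ) * d.factorial ≤ (3 / 2 * n) ^ d :=
          (multichoose_mul_factorial_le hn d).trans (by gcongr; linarith)
        have h2 : (d.factorial : ℝ) ≤ (d : ℝ) ^ d := by exact_mod_cast Nat.factorial_le_pow d
        gcongr
    _ = 4 * (3 / 4 : ℝ) ^ d := by
        rw [← mul_pow, ← mul_pow]
        congr 2
        field_simp
        norm_num

theorem norm_sq_lowDegProj_likelihoodRatio_le {n p q sx sy D : ℕ} {B : ℝ} (hB : 0 < B)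
    (hsx : 0 < sx) (hsxp : sx ≤ p) (hsy : 0 < sy) (hsyq : sy ≤ q) (hDn : D ≤ n)
    (hx : √(Real.exp 1 * n * D) / B ≤ sx) (hy : √(Real.exp 1 * n * D) / B ≤ sy)
    (hp : 3 * Real.exp 1 * n / B ^ 2 ≤ p) (hq : 3 * Real.exp 1 * n / B ^ 2 ≤ q)
    (h : MemLp (likelihoodRatio n p q sx sy B) 2 (nullSample n p q)) :
    ‖lowDegProj D (h.toLp (likelihoodRatio n p q sx sy B))‖ ^ 2 ≤ 16 := by
  rw [norm_sq_lowDegProj]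
  simp_rw [inner_hermiteL2_likelihoodRatio hB h]
  calc _ ≤ ∑ N ∈ Finset.range (D + 1) with 2 ∣ N, 4 * (3 / 4 : ℝ) ^ (N / 2) := by
        rw [Finset.sum_filter]
        refine Finset.sum_le_sum fun N hN => ?_
        split_ifs with h2
        · obtain ⟨d, rfl⟩ := h2
          rw [Nat.mul_div_cancel_left d zero_lt_two]
          exact sum_sq_integral_hermiteFun_mixture_le hB hsx hsxp hsy hsyq hDn hx hy hp hq
            (Nat.lt_succ_iff.1 (Finset.mem_range.1 hN))
        · exact (sum_sq_integral_hermiteFun_mixture_odd hB h2).le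
    _ = ∑ d ∈ ((Finset.range (D + 1)).filter (2 ∣ ·)).image (· / 2), 4 * (3 / 4 : ℝ) ^ d := by
        refine (Finset.sum_image (f := fun d => 4 * (3 / 4 : ℝ) ^ d) fun N hN N' hN' hh => ?_).symm
        have h1 := (Finset.mem_filter.1 hN).2
        have h2 := (Finset.mem_filter.1 hN').2
        have hh' : N / 2 = N' / 2 := hh
        omega
    _ ≤ ∑' d : ℕ, 4 * (3 / 4 : ℝ) ^ d :=
        ((summable_geometric_of_lt_one (by norm_num) (by norm_num)).mul_left 4).sum_le_tsum _
          fun d _ => by positivity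
    _ = 16 := by
        rw [tsum_mul_left, tsum_geometric_of_lt_one (by norm_num) (by norm_num)]
        norm_num

end SparseCCA

theorem theorem3 :
    ∃ C : ℝ, ∀ (n p q sx sy D : ℕ) (B : ℝ), 0 < B →
      0 < sx → sx ≤ p → 0 < sy → sy ≤ q →
      (D : ℝ) ≤ min (min √(p : ℝ) √(q : ℝ)) (n : ℝ) →
      √(Real.exp 1 * n * D) / B ≤ sx → √(Real.exp 1 * n * D) / B ≤ sy →
      3 * Real.exp 1 * n / B ^ 2 ≤ p → 3 * Real.exp 1 * n / B ^ 2 ≤ q →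
      SparseCCA.mixture n p q sx sy B ≪ SparseCCA.nullSample n p q ∧
      ∃ h : MemLp (SparseCCA.likelihoodRatio n p q sx sy B) 2 (SparseCCA.nullSample n p q),
        ‖SparseCCA.lowDegProj D (h.toLp (SparseCCA.likelihoodRatio n p q sx sy B))‖ ^ 2 ≤ C := by
  refine ⟨16, fun n p q sx sy D B hB hsx hsxp hsy hsyq hD hx hy hp hq => ?_⟩
  have hd := SparseCCA.hasSqDensity_mixture n p q sx sy hB
  have hDn : D ≤ n := by exact_mod_cast hD.trans (min_le_right _ _)
  exact ⟨hd.absolutelyContinuous, hd.memLp_rnDeriv,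
    SparseCCA.norm_sq_lowDegProj_likelihoodRatio_le hB hsx hsxp hsy hsyq hDn hx hy hp hq _⟩
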